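/- Let $d\ge 2$ be an integer, $q\in(1,2)$ and $\mu>0$, and put \[ V_\mu(s)=\frac{q^2(d-1)^2-2q(d-1)}{4s^2}-\frac{\mu}{s^q},\qquad s>0 . \] The operator $C_c^\infty(0,\infty)\ni f\mapsto -f''+V_\mu f$ in $L^2(0,\infty)$ is densely defined, symmetric and bounded from below. Let $L_\mu$ denote its Friedrichs extension. Then $L_\mu$ is self-adjoint, and its essential spectrum (the spectrum with all isolated eigenvalues of finite multiplicity removed) is \[ \mathrm{spec}_{\mathrm{ess}}\, L_\mu=[0,\infty). \] -/

import Mathlib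

open MeasureTheory Filter Topology Set
open scoped Distributions InnerProductSpace ContDiff

namespace LinearPMap

variable {H : Type*} [NormedAddCommGroup H] [InnerProductSpace ℂ H]

/-! ### Spectrum and essential spectrum of an unbounded operator -/

/-- `z` is in the resolvent set of `A`: the map `A - z : D(A) → H` is a bijection with a bounded
(everywhere defined) inverse `R`. -/
def IsResolventPoint (A : H →ₗ.[ℂ] H) (z : ℂ) : Prop :=
  ∃ R : H →L[ℂ] H,
    (∀ y : H, ∃ h : R y ∈ A.domain, A ⟨R y, h⟩ - z • R y = y) ∧
    (∀ x : A.domain, R (A x - z • (x : H)) = x)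

/-- The spectrum of an unbounded operator: the complement of its resolvent set. -/
def unboundedSpectrum (A : H →ₗ.[ℂ] H) : Set ℂ := {z | ¬ A.IsResolventPoint z}

/-- The eigenspace `{x ∈ D(A) | A x = z x}`. -/
def unboundedEigenspace (A : H →ₗ.[ℂ] H) (z : ℂ) : Submodule ℂ A.domain :=
  LinearMap.ker (A.toFun - z • A.domain.subtype)

/-- The discrete spectrum of a self-adjoint operator: the isolated points of the spectrum that are
eigenvalues of finite multiplicity. -/
def discreteSpectrum (A : H →ₗ.[ℂ] H) : Set ℂ :=
  {z | z ∈ A.unboundedSpectrum ∧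
    (∃ ε > 0, ∀ w ∈ A.unboundedSpectrum, dist w z < ε → w = z) ∧
    A.unboundedEigenspace z ≠ ⊥ ∧ FiniteDimensional ℂ (A.unboundedEigenspace z)}

/-- The essential spectrum of a self-adjoint operator: what remains of the spectrum after the
discrete spectrum is removed. -/
def essentialSpectrum (A : H →ₗ.[ℂ] H) : Set ℂ := A.unboundedSpectrum \ A.discreteSpectrum

/-! ### The Friedrichs extension -/

/-- Densely defined symmetric operators that are bounded from below. -/
structure IsSemibounded (S : H →ₗ.[ℂ] H) : Prop where
  dense : Dense (S.domain : Set H)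
  symm : ∀ x y : S.domain, ⟪S x, (y : H)⟫_ℂ = ⟪(x : H), S y⟫_ℂ
  bddBelow : ∃ c : ℝ, ∀ x : S.domain, -c * ‖(x : H)‖ ^ 2 ≤ (⟪(x : H), S x⟫_ℂ).re

/-- The quadratic form `x ↦ ⟨x, S x⟩` of `S` on its domain (its value is real if `S` is
symmetric). -/
noncomputable def quadForm (S : H →ₗ.[ℂ] H) (x : S.domain) : ℝ := (⟪(x : H), S x⟫_ℂ).re

theorem quadForm_smul (S : H →ₗ.[ℂ] H) (a : ℂ) (x : S.domain) :
    S.quadForm (a • x) = ‖a‖ ^ 2 * S.quadForm x := by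
  have h : ⟪((a • x : S.domain) : H), S (a • x)⟫_ℂ
      = ((‖a‖ ^ 2 : ℝ) : ℂ) * ⟪(x : H), S x⟫_ℂ := by
    rw [LinearPMap.map_smul, Submodule.coe_smul, inner_smul_left, inner_smul_right, ← mul_assoc,
      Complex.conj_mul']
    push_cast
    ring
  rw [quadForm, h, Complex.re_ofReal_mul, quadForm]

theorem quadForm_parallelogram (S : H →ₗ.[ℂ] H) (x y : S.domain) :
    S.quadForm (x + y) + S.quadForm (x - y) = 2 * S.quadForm x + 2 * S.quadForm y := by
  simp only [quadForm, LinearPMap.map_add, LinearPMap.map_sub, Submodule.coe_add,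
    Submodule.coe_sub, inner_add_left, inner_add_right, inner_sub_left, inner_sub_right,
    Complex.add_re, Complex.sub_re]
  ring

/-- The form domain of a semibounded symmetric operator `S`, i.e. the domain of the closure of its
quadratic form: the vectors `x` that are limits of a sequence in `D(S)` which is Cauchy for the
quadratic form. (A sequence that converges in `H` is Cauchy for the form norm
`(⟨x, S x⟩ + (c + 1) ‖x‖²) ^ (1/2)` exactly if the form of the differences tends to zero.) -/
noncomputable def formDomain (S : H →ₗ.[ℂ] H) (hS : S.IsSemibounded) : Submodule ℂ H where
  carrier := {x | ∃ u : ℕ → S.domain, Tendsto (fun n => (u n : H)) atTop (𝓝 x) ∧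
    Tendsto (fun p : ℕ × ℕ => S.quadForm (u p.1 - u p.2)) atTop (𝓝 0)}
  zero_mem' := ⟨fun _ => 0, by simp, by simp [quadForm]⟩
  add_mem' := by
    rintro x y ⟨u, hu, hu'⟩ ⟨v, hv, hv'⟩
    refine ⟨fun n => u n + v n, by simpa using hu.add hv, ?_⟩
    obtain ⟨c, hc⟩ := hS.bddBelow
    have key : ∀ {z : H} {w : ℕ → S.domain}, Tendsto (fun n => (w n : H)) atTop (𝓝 z) →
        Tendsto (fun p : ℕ × ℕ => c * ‖((w p.1 - w p.2 : S.domain) : H)‖ ^ 2) atTop (𝓝 0) := by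
      intro z w hw
      have h1 : Tendsto (fun p : ℕ × ℕ => (w p.1 : H)) atTop (𝓝 z) := by
        rw [← prod_atTop_atTop_eq]; exact hw.comp tendsto_fst
      have h2 : Tendsto (fun p : ℕ × ℕ => (w p.2 : H)) atTop (𝓝 z) := by
        rw [← prod_atTop_atTop_eq]; exact hw.comp tendsto_snd
      simpa using ((h1.sub h2).norm.pow 2).const_mul c
    have huv : Tendsto (fun n => ((u n + v n : S.domain) : H)) atTop (𝓝 (x + y)) := by
      simpa using hu.add hv
    have huv' : Tendsto (fun n => ((u n - v n : S.domain) : H)) atTop (𝓝 (x - y)) := by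
      simpa using hu.sub hv
    have lower := (key huv).neg
    have upper := ((hu'.const_mul 2).add (hv'.const_mul 2)).add (key huv')
    simp only [mul_zero, add_zero, neg_zero] at lower upper
    refine tendsto_of_tendsto_of_tendsto_of_le_of_le lower upper (fun p => ?_) (fun p => ?_)
    · have := hc ((u p.1 + v p.1) - (u p.2 + v p.2))
      simp only [quadForm]
      linarith
    · have e1 : (u p.1 + v p.1) - (u p.2 + v p.2) = (u p.1 - u p.2) + (v p.1 - v p.2) := by abel
      have e2 : (u p.1 - v p.1) - (u p.2 - v p.2) = (u p.1 - u p.2) - (v p.1 - v p.2) := by abel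
      have h1 := quadForm_parallelogram S (u p.1 - u p.2) (v p.1 - v p.2)
      have h2 := hc ((u p.1 - u p.2) - (v p.1 - v p.2))
      change _ ≤ S.quadForm _ at h2
      change S.quadForm ((u p.1 + v p.1) - (u p.2 + v p.2)) ≤
        2 * S.quadForm (u p.1 - u p.2) + 2 * S.quadForm (v p.1 - v p.2) +
          c * ‖(((u p.1 - v p.1) - (u p.2 - v p.2) : S.domain) : H)‖ ^ 2
      rw [e1, e2]
      linarith
  smul_mem' := by
    rintro a x ⟨u, hu, hu'⟩
    refine ⟨fun n => a • u n, by simpa using hu.const_smul a, ?_⟩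
    simpa [← smul_sub, quadForm_smul] using hu'.const_mul (‖a‖ ^ 2)

/-- The Friedrichs extension of a densely defined semibounded symmetric operator `S`: the
restriction of the adjoint of `S` to the vectors of its domain that lie in the form domain.
Equivalently, it is the self-adjoint operator of the closure `q` of the quadratic form of `S`:
`x ∈ D(q)` is in its domain with value `w` if and only if `q(φ, x) = ⟨φ, w⟩` for all
`φ ∈ D(S)`. -/
noncomputable def friedrichsExtension [CompleteSpace H] (S : H →ₗ.[ℂ] H)
    (hS : S.IsSemibounded) : H →ₗ.[ℂ] H :=
  S.adjoint.domRestrict (S.formDomain hS)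

end LinearPMap

namespace HalfLine

/-- Lebesgue measure on the half-line `(0, ∞)`. -/
noncomputable abbrev halfMeasure : Measure ℝ := volume.restrict (Ioi (0 : ℝ))

/-- The Hilbert space `L²(0, ∞)` of complex-valued functions. -/
noncomputable abbrev L2 : Type := Lp ℂ 2 halfMeasure

/-- The half-line as an open set. -/
def halfLine : TopologicalSpace.Opens ℝ := ⟨Ioi 0, isOpen_Ioi⟩

/-- The space `C_c^∞(0, ∞)` of complex-valued test functions. (Each is extended by zero to a smooth
function on `ℝ`, with compact support contained in `(0, ∞)`.) -/
abbrev Test : Type := 𝓓(halfLine, ℂ)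

/-- The potential `V_μ(s) = (q²(d-1)² - 2q(d-1)) / (4s²) - μ / s^q`, for `s > 0`. -/
noncomputable def potential (d : ℕ) (q μ s : ℝ) : ℝ :=
  (q ^ 2 * ((d : ℝ) - 1) ^ 2 - 2 * q * ((d : ℝ) - 1)) / (4 * s ^ 2) - μ / s ^ q

/-- The function `-f'' + V_μ f`. -/
noncomputable def diffExpr (d : ℕ) (q μ : ℝ) (f : ℝ → ℂ) (s : ℝ) : ℂ :=
  -deriv (deriv f) s + (potential d q μ s : ℂ) * f s

theorem test_contDiff (f : Test) : ContDiff ℝ ∞ (f : ℝ → ℂ) := f.contDiff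

theorem test_contDiff_deriv (f : Test) : ContDiff ℝ ∞ (deriv (f : ℝ → ℂ)) :=
  (contDiff_infty_iff_deriv.1 (test_contDiff f)).2

theorem continuousOn_potential (d : ℕ) (q μ : ℝ) : ContinuousOn (potential d q μ) (Ioi 0) := by
  intro s hs
  have hs' : (0 : ℝ) < s := hs
  have h1 : (4 * s ^ 2 : ℝ) ≠ 0 := by positivity
  have h2 : s ^ q ≠ 0 := (Real.rpow_pos_of_pos hs' q).ne'
  have h3 : ContinuousAt (fun s : ℝ => s ^ q) s :=
    Real.continuousAt_rpow_const s q (Or.inl hs'.ne')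
  have h4 : ContinuousAt (fun s : ℝ => 4 * s ^ 2) s := by fun_prop
  have h5 : ContinuousAt (fun s : ℝ => μ / s ^ q) s := continuousAt_const.div h3 h2
  have h6 : ContinuousAt (fun s : ℝ =>
      (q ^ 2 * ((d : ℝ) - 1) ^ 2 - 2 * q * ((d : ℝ) - 1)) / (4 * s ^ 2)) s :=
    continuousAt_const.div h4 h1
  exact (h6.sub h5).continuousWithinAt

theorem continuous_diffExpr (d : ℕ) (q μ : ℝ) (f : Test) :
    Continuous (diffExpr d q μ f) := by
  have h2 : Continuous (deriv (deriv (f : ℝ → ℂ))) :=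
    (test_contDiff_deriv f).continuous_deriv (by norm_num)
  refine h2.neg.add ?_
  refine continuous_iff_continuousAt.2 fun s => ?_
  by_cases hs : s ∈ Ioi (0 : ℝ)
  · exact (Complex.continuous_ofReal.continuousAt.comp
      ((continuousOn_potential d q μ).continuousAt (isOpen_Ioi.mem_nhds hs))).mul
      f.continuous.continuousAt
  · have hs' : s ∉ tsupport (f : ℝ → ℂ) := fun h => hs (f.tsupport_subset h)
    have h0 : (f : ℝ → ℂ) =ᶠ[𝓝 s] 0 := notMem_tsupport_iff_eventuallyEq.1 hs'
    refine (continuousAt_const (y := (0 : ℂ))).congr ?_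
    filter_upwards [h0] with t ht
    simp [ht]

theorem hasCompactSupport_diffExpr (d : ℕ) (q μ : ℝ) (f : Test) :
    HasCompactSupport (diffExpr d q μ f) :=
  f.hasCompactSupport.deriv.deriv.neg.add f.hasCompactSupport.mul_left

theorem memLp_test (f : Test) : MemLp (f : ℝ → ℂ) 2 halfMeasure :=
  (f.continuous.memLp_of_hasCompactSupport f.hasCompactSupport).restrict _

theorem memLp_diffExpr (d : ℕ) (q μ : ℝ) (f : Test) :
    MemLp (diffExpr d q μ f) 2 halfMeasure :=
  ((continuous_diffExpr d q μ f).memLp_of_hasCompactSupport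
    (hasCompactSupport_diffExpr d q μ f)).restrict _

/-- The embedding `C_c^∞(0, ∞) → L²(0, ∞)`. -/
noncomputable def testToL2 : Test →ₗ[ℂ] L2 where
  toFun f := (memLp_test f).toLp f
  map_add' f g := MemLp.toLp_add (memLp_test f) (memLp_test g)
  map_smul' c f := MemLp.toLp_const_smul c (memLp_test f)

theorem testToL2_injective : Function.Injective testToL2 := by
  intro f g h
  have h1 : (f : ℝ → ℂ) =ᵐ[halfMeasure] g :=
    (MemLp.toLp_eq_toLp_iff (memLp_test f) (memLp_test g)).1 h
  have h2 : EqOn (f : ℝ → ℂ) g (Ioi 0) :=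
    Measure.eqOn_open_of_ae_eq h1 isOpen_Ioi f.continuous.continuousOn g.continuous.continuousOn
  refine TestFunction.ext fun s => ?_
  by_cases hs : s ∈ Ioi (0 : ℝ)
  · exact h2 hs
  · rw [image_eq_zero_of_notMem_tsupport fun h => hs (f.tsupport_subset h),
      image_eq_zero_of_notMem_tsupport fun h => hs (g.tsupport_subset h)]

/-- The map `C_c^∞(0, ∞) → L²(0, ∞)`, `f ↦ -f'' + V_μ f`. -/
noncomputable def diffExprToL2 (d : ℕ) (q μ : ℝ) : Test →ₗ[ℂ] L2 where
  toFun f := (memLp_diffExpr d q μ f).toLp (diffExpr d q μ f)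
  map_add' f g := by
    rw [← MemLp.toLp_add]
    congr 1
    have e : deriv ((f + g : Test) : ℝ → ℂ) = deriv f + deriv g := by
      funext s
      exact deriv_add ((test_contDiff f).differentiable (by norm_num) s)
        ((test_contDiff g).differentiable (by norm_num) s)
    funext s
    have e2 : deriv (deriv (f : ℝ → ℂ) + deriv g) s = deriv (deriv f) s + deriv (deriv g) s :=
      deriv_add ((test_contDiff_deriv f).differentiable (by norm_num) s)
        ((test_contDiff_deriv g).differentiable (by norm_num) s)
    have e3 : (f + g : Test) s = f s + g s := rfl
    simp only [diffExpr, Pi.add_apply, e, e2, e3]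
    ring
  map_smul' c f := by
    rw [RingHom.id_apply, ← MemLp.toLp_const_smul]
    congr 1
    have e : deriv ((c • f : Test) : ℝ → ℂ) = c • deriv f := by
      funext s
      exact deriv_const_smul c ((test_contDiff f).differentiable (by norm_num) s)
    funext s
    have e2 : deriv (c • deriv (f : ℝ → ℂ)) s = c • deriv (deriv f) s :=
      deriv_const_smul c ((test_contDiff_deriv f).differentiable (by norm_num) s)
    have e3 : (c • f : Test) s = c • f s := rfl
    simp only [diffExpr, Pi.smul_apply, e, e2, e3, smul_eq_mul]
    ring

/-- The operator `f ↦ -f'' + V_μ f` in `L²(0, ∞)` with domain `C_c^∞(0, ∞)`. -/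
noncomputable def minimalOperator (d : ℕ) (q μ : ℝ) : L2 →ₗ.[ℂ] L2 where
  domain := LinearMap.range testToL2
  toFun := (diffExprToL2 d q μ).comp
    (LinearEquiv.ofInjective testToL2 testToL2_injective).symm.toLinearMap

/-- On a test function `f` the operator `minimalOperator` takes the value `-f'' + V_μ f`. -/
theorem minimalOperator_apply (d : ℕ) (q μ : ℝ) (f : Test) :
    minimalOperator d q μ ⟨testToL2 f, LinearMap.mem_range_self _ f⟩ = diffExprToL2 d q μ f := by
  exact congrArg (diffExprToL2 d q μ)
    ((LinearEquiv.ofInjective testToL2 testToL2_injective).symm_apply_apply f)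

end HalfLine

/-! Let `c` be the coefficient of `s⁻²` in the potential. Then `1 + 4c = (q(d-1) - 1)²`, which is
positive because `q(d-1) > 1`. By Hardy's inequality the form of `-f'' + c s⁻² f` therefore
dominates `θ ∫ |f'|²` for some `θ > 0` (`exists_pos_hardy`). Since `0 < q < 2`, the term `s^(-q)` is
at most a small multiple of `s⁻²` near `0`, small near infinity, and bounded in between. On a
bounded interval the `L²` norm is controlled by a small multiple of `∫ |f'|²` and finitely many cell
averages. Hence for each `ε > 0` the whole form is at least `-ε ‖f‖²` minus a form of finite rank
(`exists_le_quadForm`). This gives semiboundedness, and the bound passes to the Friedrichs extension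
`A`.

Such a bound makes the negative spectrum discrete. For `a < 0`, bounded sequences with `(A - a) u_n
→ 0` have convergent subsequences (`exists_eigenvector_of_tendsto`), so negative spectral points are
isolated eigenvalues of finite multiplicity. For `r ≥ 0`, the waves `exp(i √r s)` cut off to `[n,
5n]` are approximate eigenvectors, because the potential decays. So `[0, ∞)` lies in the spectrum,
and none of its points is isolated.

Self-adjointness is variational: minimising the shifted quadratic functional solves `(A + k) x = w`
for every `w`, and a densely defined symmetric operator with `A + k` onto for a real `k` is
self-adjoint. -/

namespace LinearPMap

variable {H : Type*} [NormedAddCommGroup H] [InnerProductSpace ℂ H]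

/-! ### Self-adjointness of the Friedrichs extension -/

/-- The sesquilinear form `⟨x, S y⟩ + k ⟨x, y⟩` on the domain of `S`. -/
noncomputable def shiftedForm (S : H →ₗ.[ℂ] H) (k : ℝ) (x y : S.domain) : ℂ :=
  ⟪(x : H), S y⟫_ℂ + k * ⟪(x : H), (y : H)⟫_ℂ

/-! ### The shifted form as a semi-inner product -/

section ShiftedForm

variable {S : H →ₗ.[ℂ] H} {k : ℝ}

theorem shiftedForm_add_left (x y z : S.domain) :
    S.shiftedForm k (x + y) z = S.shiftedForm k x z + S.shiftedForm k y z := by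
  simp only [shiftedForm, Submodule.coe_add, inner_add_left]; ring

theorem shiftedForm_add_right (x y z : S.domain) :
    S.shiftedForm k x (y + z) = S.shiftedForm k x y + S.shiftedForm k x z := by
  simp only [shiftedForm, LinearPMap.map_add, Submodule.coe_add, inner_add_right]; ring

theorem shiftedForm_sub_right (x y z : S.domain) :
    S.shiftedForm k x (y - z) = S.shiftedForm k x y - S.shiftedForm k x z := by
  simp only [shiftedForm, LinearPMap.map_sub, Submodule.coe_sub, inner_sub_right]; ring

theorem shiftedForm_smul_left (a : ℂ) (x y : S.domain) :
    S.shiftedForm k (a • x) y = (starRingEnd ℂ) a * S.shiftedForm k x y := by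
  simp only [shiftedForm, Submodule.coe_smul, inner_smul_left]; ring

theorem shiftedForm_smul_right (a : ℂ) (x y : S.domain) :
    S.shiftedForm k x (a • y) = a * S.shiftedForm k x y := by
  simp only [shiftedForm, LinearPMap.map_smul, Submodule.coe_smul, inner_smul_right]; ring

theorem re_shiftedForm_self (x : S.domain) :
    (S.shiftedForm k x x).re = S.quadForm x + k * ‖(x : H)‖ ^ 2 := by
  rw [shiftedForm, Complex.add_re, Complex.re_ofReal_mul, quadForm]
  congr 2
  exact inner_self_eq_norm_sq (𝕜 := ℂ) (x : H)

theorem conj_shiftedForm (hS : S.IsSemibounded) (x y : S.domain) :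
    (starRingEnd ℂ) (S.shiftedForm k x y) = S.shiftedForm k y x := by
  simp only [shiftedForm, _root_.map_add, _root_.map_mul, Complex.conj_ofReal, inner_conj_symm]
  rw [hS.symm]

theorem shiftedForm_eq_inner_left (hS : S.IsSemibounded) (x y : S.domain) :
    S.shiftedForm k x y = ⟪S x, (y : H)⟫_ℂ + k * ⟪(x : H), (y : H)⟫_ℂ := by
  rw [shiftedForm, hS.symm]

/-- Cauchy–Schwarz for a semi-inner product; definiteness is not needed. -/
theorem norm_shiftedForm_sq_le (hS : S.IsSemibounded)
    (hk : ∀ x, 0 ≤ (S.shiftedForm k x x).re) (x y : S.domain) :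
    ‖S.shiftedForm k x y‖ ^ 2 ≤ (S.shiftedForm k x x).re * (S.shiftedForm k y y).re := by
  let core : PreInnerProductSpace.Core ℂ S.domain :=
    { inner := S.shiftedForm k
      conj_inner_symm := fun x y => conj_shiftedForm hS y x
      re_inner_nonneg := hk
      add_left := shiftedForm_add_left
      smul_left := fun x y a => shiftedForm_smul_left a x y }
  have h := @InnerProductSpace.Core.inner_mul_inner_self_le ℂ S.domain _ _ _ core x y
  have e : ‖S.shiftedForm k y x‖ = ‖S.shiftedForm k x y‖ := by
    rw [← conj_shiftedForm hS x y, RCLike.norm_conj]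
  calc ‖S.shiftedForm k x y‖ ^ 2 = ‖S.shiftedForm k x y‖ * ‖S.shiftedForm k y x‖ := by rw [e, sq]
    _ ≤ _ := h

theorem re_shiftedForm_add_add_sub (x y : S.domain) :
    (S.shiftedForm k (x + y) (x + y)).re + (S.shiftedForm k (x - y) (x - y)).re =
      2 * (S.shiftedForm k x x).re + 2 * (S.shiftedForm k y y).re := by
  have h1 := quadForm_parallelogram S x y
  have h2 := parallelogram_law_with_norm ℂ (x : H) (y : H)
  simp only [re_shiftedForm_self, Submodule.coe_add, Submodule.coe_sub]
  linear_combination h1 + k * h2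

end ShiftedForm

/-- `u` converges to `x` in the norm of the quadratic form of `S`. -/
def FormConverges (S : H →ₗ.[ℂ] H) (u : ℕ → S.domain) (x : H) : Prop :=
  Tendsto (fun n => (u n : H)) atTop (𝓝 x) ∧
    Tendsto (fun p : ℕ × ℕ => S.quadForm (u p.1 - u p.2)) atTop (𝓝 0)

namespace FormConverges

variable {S : H →ₗ.[ℂ] H} {k : ℝ}

theorem const (x : S.domain) : S.FormConverges (fun _ => x) (x : H) :=
  ⟨tendsto_const_nhds, by simp [quadForm]⟩

theorem tendsto_shiftedForm {u : ℕ → S.domain} {x : H} (hu : S.FormConverges u x) (k : ℝ) :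
    Tendsto (fun p : ℕ × ℕ => (S.shiftedForm k (u p.1 - u p.2) (u p.1 - u p.2)).re)
      atTop (𝓝 0) := by
  simp only [re_shiftedForm_self]
  have h1 : Tendsto (fun p : ℕ × ℕ => (u p.1 : H)) atTop (𝓝 x) := by
    rw [← prod_atTop_atTop_eq]; exact hu.1.comp tendsto_fst
  have h2 : Tendsto (fun p : ℕ × ℕ => (u p.2 : H)) atTop (𝓝 x) := by
    rw [← prod_atTop_atTop_eq]; exact hu.1.comp tendsto_snd
  simpa using hu.2.add (((h1.sub h2).norm.pow 2).const_mul k)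

/-- A Cauchy sequence for a seminorm is bounded: the parallelogram law is applied to `u n - u M` and
`u M` with `M` fixed. -/
theorem exists_bound {u : ℕ → S.domain} {x : H} (hu : S.FormConverges u x)
    (hk : ∀ x, 0 ≤ (S.shiftedForm k x x).re) :
    ∃ C, 0 ≤ C ∧ ∀ᶠ n in atTop, (S.shiftedForm k (u n) (u n)).re ≤ C := by
  have h := (hu.tendsto_shiftedForm k).eventually (gt_mem_nhds zero_lt_one)
  obtain ⟨⟨N, M⟩, hN⟩ := eventually_atTop.1 h
  refine ⟨2 + 2 * (S.shiftedForm k (u M) (u M)).re, by linarith [hk (u M)], ?_⟩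
  filter_upwards [eventually_ge_atTop N] with n hn
  have h1 := hN (n, M) ⟨hn, le_rfl⟩
  have h2 := re_shiftedForm_add_add_sub (k := k) (u n - u M) (u M)
  have h3 := hk (u n - u M - u M)
  rw [sub_add_cancel] at h2
  simp only at h1
  linarith

/-- The form of two sequences converges to the value determined by the adjoint of `S`. -/
theorem tendsto_shiftedForm_adjoint [CompleteSpace H] (hS : S.IsSemibounded)
    (hk : ∀ x, 0 ≤ (S.shiftedForm k x x).re)
    {u v : ℕ → S.domain} {x : H} {y : S.adjoint.domain}
    (hu : S.FormConverges u x) (hv : S.FormConverges v (y : H)) :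
    Tendsto (fun n => S.shiftedForm k (u n) (v n)) atTop
      (𝓝 (⟪x, S.adjoint y⟫_ℂ + k * ⟪x, (y : H)⟫_ℂ)) := by
  -- `L n` is the limit of the form of `u n` and `v m` as `m → ∞`. It converges to the claimed
  -- value, so it remains to compare it with the diagonal.
  set L : ℕ → ℂ := fun n => ⟪(u n : H), S.adjoint y⟫_ℂ + k * ⟪(u n : H), (y : H)⟫_ℂ with hLdef
  have hL : Tendsto L atTop (𝓝 (⟪x, S.adjoint y⟫_ℂ + k * ⟪x, (y : H)⟫_ℂ)) :=
    (hu.1.inner tendsto_const_nhds).add ((hu.1.inner tendsto_const_nhds).const_mul _)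
  have hrow : ∀ n, Tendsto (fun m => S.shiftedForm k (u n) (v m)) atTop (𝓝 (L n)) := by
    intro n
    have e : L n = ⟪S (u n), (y : H)⟫_ℂ + k * ⟪(u n : H), (y : H)⟫_ℂ := by
      have h := S.adjoint_isFormalAdjoint hS.dense y (u n)
      have h' := congrArg (starRingEnd ℂ) h
      simp only [inner_conj_symm] at h'
      simp only [hLdef, h']
    rw [e]
    simp only [shiftedForm_eq_inner_left hS]
    exact (tendsto_const_nhds.inner hv.1).add ((tendsto_const_nhds.inner hv.1).const_mul _)
  obtain ⟨C, hC0, hC⟩ := hu.exists_bound hk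
  -- By Cauchy–Schwarz the squared difference is at most the limit over `m` of `C` times the form of
  -- `v m - v n`. Dividing by `C + 1` in the choice of `δ` allows `C = 0`.
  have hdiff : Tendsto (fun n => ‖L n - S.shiftedForm k (u n) (v n)‖ ^ 2) atTop (𝓝 0) := by
    rw [Metric.tendsto_atTop]
    intro ε hε
    have hδ : 0 < ε / (2 * (C + 1)) := by positivity
    obtain ⟨⟨N, M⟩, hN⟩ :=
      eventually_atTop.1 ((hv.tendsto_shiftedForm k).eventually (gt_mem_nhds hδ))
    obtain ⟨K, hK⟩ := eventually_atTop.1 hC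
    refine ⟨max K M, fun n hn => ?_⟩
    have hb : ‖L n - S.shiftedForm k (u n) (v n)‖ ^ 2 ≤ ε / 2 := by
      refine le_of_tendsto (((hrow n).sub_const _).norm.pow 2) ?_
      filter_upwards [eventually_ge_atTop N] with m hm
      rw [← shiftedForm_sub_right]
      refine (norm_shiftedForm_sq_le hS hk _ _).trans ?_
      have h1 := hN (m, n) ⟨hm, (le_max_right _ _).trans hn⟩
      have h2 := hK n ((le_max_left _ _).trans hn)
      calc _ ≤ C * (ε / (2 * (C + 1))) := mul_le_mul h2 h1.le (hk _) hC0
        _ ≤ (C + 1) * (ε / (2 * (C + 1))) := by gcongr; linarith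
        _ = ε / 2 := by field_simp
    rw [dist_zero_right, Real.norm_of_nonneg (sq_nonneg _)]
    linarith
  have hdiff' : Tendsto (fun n => L n - S.shiftedForm k (u n) (v n)) atTop (𝓝 0) := by
    rw [tendsto_zero_iff_norm_tendsto_zero]
    have := hdiff.sqrt
    simpa [Real.sqrt_sq (norm_nonneg _)] using this
  simpa using hL.sub hdiff'

end FormConverges

/-- With the shift `c + 1` instead of `c` the form dominates the norm, so sequences that are Cauchy
for the form are Cauchy in `H`. -/
theorem exists_shift {S : H →ₗ.[ℂ] H} (hS : S.IsSemibounded) :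
    ∃ k : ℝ, ∀ x : S.domain, ‖(x : H)‖ ^ 2 ≤ (S.shiftedForm k x x).re := by
  obtain ⟨c, hc⟩ := hS.bddBelow
  refine ⟨c + 1, fun x => ?_⟩
  have := hc x
  rw [re_shiftedForm_self, quadForm]
  linarith

/-! ### Symmetry of the extension and the variational problem -/

section Friedrichs

variable [CompleteSpace H] {S : H →ₗ.[ℂ] H} (hS : S.IsSemibounded)

theorem mem_friedrichsExtension_domain {x : H} :
    x ∈ (S.friedrichsExtension hS).domain ↔
      x ∈ S.adjoint.domain ∧ ∃ u, S.FormConverges u x :=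
  and_comm

theorem friedrichsExtension_apply (x : (S.friedrichsExtension hS).domain)
    (hx : (x : H) ∈ S.adjoint.domain) :
    S.friedrichsExtension hS x = S.adjoint ⟨x, hx⟩ := rfl

/-- The form of `u n` and `v n` has one limit, which is computed once through the adjoint at `y` and
once, after conjugation, through the adjoint at `x`. -/
theorem friedrichsExtension_inner_symm (x y : (S.friedrichsExtension hS).domain) :
    ⟪S.friedrichsExtension hS x, (y : H)⟫_ℂ = ⟪(x : H), S.friedrichsExtension hS y⟫_ℂ := by
  obtain ⟨hx, u, hu⟩ := (mem_friedrichsExtension_domain hS).1 x.2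
  obtain ⟨hy, v, hv⟩ := (mem_friedrichsExtension_domain hS).1 y.2
  obtain ⟨k, hk⟩ := exists_shift hS
  have hk' : ∀ x, 0 ≤ (S.shiftedForm k x x).re := fun x => (sq_nonneg _).trans (hk x)
  have h1 := FormConverges.tendsto_shiftedForm_adjoint (y := ⟨y, hy⟩) hS hk' hu hv
  have h2 := FormConverges.tendsto_shiftedForm_adjoint (y := ⟨x, hx⟩) hS hk' hv hu
  have h3 := (Complex.continuous_conj.tendsto _).comp h2
  have e : (⇑(starRingEnd ℂ) ∘ fun n => S.shiftedForm k (v n) (u n)) =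
      fun n => S.shiftedForm k (u n) (v n) := by
    funext n
    exact conj_shiftedForm hS _ _
  rw [e] at h3
  have h4 := tendsto_nhds_unique h1 h3
  rw [friedrichsExtension_apply hS x hx, friedrichsExtension_apply hS y hy]
  simpa [eq_comm] using h4

/-- Vectors in the domain of the Friedrichs extension are approximated by vectors in the domain of
`S` together with the value of the quadratic form. -/
theorem exists_tendsto_quadForm (x : (S.friedrichsExtension hS).domain) :
    ∃ u : ℕ → S.domain, Tendsto (fun n => (u n : H)) atTop (𝓝 x) ∧
      Tendsto (fun n => S.quadForm (u n)) atTop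
        (𝓝 (⟪(x : H), S.friedrichsExtension hS x⟫_ℂ).re) := by
  obtain ⟨hx, u, hu⟩ := (mem_friedrichsExtension_domain hS).1 x.2
  obtain ⟨k, hk⟩ := exists_shift hS
  have hk' : ∀ x, 0 ≤ (S.shiftedForm k x x).re := fun x => (sq_nonneg _).trans (hk x)
  refine ⟨u, hu.1, ?_⟩
  have h1 := FormConverges.tendsto_shiftedForm_adjoint (y := ⟨x, hx⟩) hS hk' hu hu
  have h2 := (Complex.continuous_re.tendsto _).comp h1
  have h3 := h2.sub ((hu.1.norm.pow 2).const_mul k)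
  have e : (⟪(x : H), (x : H)⟫_ℂ).re = ‖(x : H)‖ ^ 2 := inner_self_eq_norm_sq (𝕜 := ℂ) (x : H)
  simp only [Function.comp_def, re_shiftedForm_self, add_sub_cancel_right, Complex.add_re,
    Complex.re_ofReal_mul, e] at h3
  exact h3

theorem le_friedrichsExtension : S ≤ S.friedrichsExtension hS := by
  have h : S ≤ S.adjoint :=
    (show S.IsFormalAdjoint S from fun x y => hS.symm x y).le_adjoint hS.dense
  refine ⟨fun x hx => (mem_friedrichsExtension_domain hS).2
    ⟨h.1 hx, _, FormConverges.const ⟨x, hx⟩⟩, fun x y hxy => ?_⟩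
  exact h.2 (x := x) (y := ⟨y, ((mem_friedrichsExtension_domain hS).1 y.2).1⟩) hxy

theorem dense_friedrichsExtension_domain : Dense ((S.friedrichsExtension hS).domain : Set H) :=
  hS.dense.mono (le_friedrichsExtension hS).1

/-- The minimiser of `⟨x, (S + k) x⟩ - 2 Re ⟨x, w⟩` solves `(A + k) x = w` for the Friedrichs
extension `A` of `S`. -/
theorem exists_friedrichsExtension_add_eq {k : ℝ}
    (hk : ∀ x : S.domain, ‖(x : H)‖ ^ 2 ≤ (S.shiftedForm k x x).re) (w : H) :
    ∃ x : (S.friedrichsExtension hS).domain,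
      S.friedrichsExtension hS x + (k : ℂ) • (x : H) = w := by
  have hk' : ∀ x, 0 ≤ (S.shiftedForm k x x).re := fun x => (sq_nonneg _).trans (hk x)
  set J : S.domain → ℝ := fun f => (S.shiftedForm k f f).re - 2 * (⟪(f : H), w⟫_ℂ).re with hJ
  have hJb : BddBelow (range J) := by
    refine ⟨-‖w‖ ^ 2, ?_⟩
    rintro _ ⟨f, rfl⟩
    have h1 := hk f
    have h2 : (⟪(f : H), w⟫_ℂ).re ≤ ‖(f : H)‖ * ‖w‖ := re_inner_le_norm (𝕜 := ℂ) _ _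
    simp only [hJ]
    nlinarith [sq_nonneg (‖(f : H)‖ - ‖w‖)]
  set I := ⨅ f, J f with hI
  have hIle : ∀ f, I ≤ J f := fun f => ciInf_le hJb f
  have hex : ∀ n : ℕ, ∃ f, J f < I + 1 / ((n : ℝ) + 1) := fun n =>
    exists_lt_of_ciInf_lt (lt_add_of_pos_right _ Nat.one_div_pos_of_nat)
  choose u hu using hex
  have hlim : Tendsto (fun n => J (u n) - I) atTop (𝓝 0) := by
    refine squeeze_zero (fun n => by linarith [hIle (u n)]) (fun n => ?_)
      tendsto_one_div_add_atTop_nhds_zero_nat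
    linarith [hu n]
  -- Comparing `J` at the midpoint of `f` and `g` with its infimum, the parallelogram law makes
  -- every minimising sequence Cauchy for the form.
  have hJmid : ∀ f g, (S.shiftedForm k (f - g) (f - g)).re ≤ 2 * (J f - I) + 2 * (J g - I) := by
    intro f g
    have h1 := re_shiftedForm_add_add_sub (k := k) f g
    have h2 := hIle ((2⁻¹ : ℂ) • (f + g))
    have h3 : J ((2⁻¹ : ℂ) • (f + g)) = (S.shiftedForm k (f + g) (f + g)).re / 4
        - ((⟪(f : H), w⟫_ℂ).re + (⟪(g : H), w⟫_ℂ).re) := by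
      simp only [hJ, shiftedForm_smul_left, shiftedForm_smul_right, Submodule.coe_smul,
        Submodule.coe_add, inner_smul_left, inner_add_left]
      have e : (starRingEnd ℂ) (2⁻¹ : ℂ) = ((2⁻¹ : ℝ) : ℂ) := by
        rw [← Complex.conj_ofReal]; simp
      have e' : (2⁻¹ : ℂ) = ((2⁻¹ : ℝ) : ℂ) := by simp
      rw [e, e', Complex.re_ofReal_mul, Complex.re_ofReal_mul, Complex.re_ofReal_mul,
        Complex.add_re]
      ring
    rw [h3] at h2
    simp only [hJ]
    linarith
  have hpair : Tendsto (fun p : ℕ × ℕ => 2 * (J (u p.1) - I) + 2 * (J (u p.2) - I))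
      atTop (𝓝 0) := by
    rw [← prod_atTop_atTop_eq]
    simpa using ((hlim.comp tendsto_fst).const_mul 2).add ((hlim.comp tendsto_snd).const_mul 2)
  have hform : Tendsto (fun p : ℕ × ℕ => (S.shiftedForm k (u p.1 - u p.2) (u p.1 - u p.2)).re)
      atTop (𝓝 0) :=
    squeeze_zero (fun p => hk' _) (fun p => hJmid _ _) hpair
  have hnorm : Tendsto (fun p : ℕ × ℕ => ‖(u p.1 : H) - u p.2‖ ^ 2) atTop (𝓝 0) :=
    squeeze_zero (fun p => sq_nonneg _) (fun p => hk (u p.1 - u p.2)) hform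
  have hcauchy : CauchySeq (fun n => (u n : H)) := by
    rw [cauchySeq_iff_tendsto_dist_atTop_0]
    have := hnorm.sqrt
    simpa [Real.sqrt_sq (norm_nonneg _), dist_eq_norm] using this
  obtain ⟨x, hx⟩ := cauchySeq_tendsto_of_complete hcauchy
  have hconv : S.FormConverges u x := by
    refine ⟨hx, ?_⟩
    have := hform.sub (hnorm.const_mul k)
    simpa [re_shiftedForm_self] using this
  -- The Euler–Lagrange equation in the limit; the infimum need not be attained in the domain of
  -- `S`. Moving `u n` by `-r E f` with `r = 1 / (β + 1)` lowers `J` by at least `r ‖E‖²`, which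
  -- cannot exceed `J (u n) - I`.
  have hEL : ∀ f, Tendsto (fun n => S.shiftedForm k f (u n)) atTop (𝓝 ⟪(f : H), w⟫_ℂ) := by
    intro f
    set β := (S.shiftedForm k f f).re with hβ
    have hβ0 : 0 ≤ β := hk' f
    have hbound : ∀ n, ‖S.shiftedForm k f (u n) - ⟪(f : H), w⟫_ℂ‖ ^ 2
        ≤ (β + 1) * (J (u n) - I) := by
      intro n
      set E := S.shiftedForm k f (u n) - ⟪(f : H), w⟫_ℂ with hE
      set r : ℝ := 1 / (β + 1) with hr
      have h1 := hIle (u n + (-(r : ℂ) * E) • f)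
      have h2 : J (u n + (-(r : ℂ) * E) • f) = J (u n) - 2 * r * ‖E‖ ^ 2 + r ^ 2 * ‖E‖ ^ 2 * β := by
        have e1 : S.shiftedForm k (u n) f = (starRingEnd ℂ) (S.shiftedForm k f (u n)) :=
          (conj_shiftedForm hS _ _).symm
        have e2 : S.shiftedForm k f (u n) = E + ⟪(f : H), w⟫_ℂ := by rw [hE]; ring
        have e3 : ‖E‖ ^ 2 = E.re ^ 2 + E.im ^ 2 := by
          rw [← Complex.normSq_eq_norm_sq, Complex.normSq_apply]; ring
        have e4 : (S.shiftedForm k f f).im = 0 :=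
          Complex.conj_eq_iff_im.1 (conj_shiftedForm hS f f)
        simp only [hJ, shiftedForm_add_left, shiftedForm_add_right, shiftedForm_smul_left,
          shiftedForm_smul_right, Submodule.coe_smul, Submodule.coe_add, inner_smul_left,
          inner_add_left, e1, e2, e3, hβ]
        simp [e4, -inner_conj_symm]
        ring
      have hr1 : r * (β + 1) = 1 := by rw [hr]; field_simp
      have hr0 : 0 ≤ r := by positivity
      have h3 : ‖E‖ ^ 2 * r ≤ J (u n) - I := by
        have : r ^ 2 * β ≤ r := by nlinarith
        nlinarith [sq_nonneg ‖E‖]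
      calc ‖E‖ ^ 2 = (β + 1) * (‖E‖ ^ 2 * r) := by linear_combination (-‖E‖ ^ 2) * hr1
        _ ≤ _ := by gcongr
    have h4 : Tendsto (fun n => ‖S.shiftedForm k f (u n) - ⟪(f : H), w⟫_ℂ‖ ^ 2) atTop (𝓝 0) :=
      squeeze_zero (fun n => sq_nonneg _) hbound (by simpa using hlim.const_mul (β + 1))
    rw [tendsto_iff_norm_sub_tendsto_zero]
    have := h4.sqrt
    simpa [Real.sqrt_sq (norm_nonneg _)] using this
  have hweak : ∀ f : S.domain, ⟪S f, x⟫_ℂ + k * ⟪(f : H), x⟫_ℂ = ⟪(f : H), w⟫_ℂ := by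
    intro f
    refine tendsto_nhds_unique ?_ (hEL f)
    simp only [shiftedForm_eq_inner_left hS]
    exact (tendsto_const_nhds.inner hx).add ((tendsto_const_nhds.inner hx).const_mul _)
  have hadj : ∀ f : S.domain, ⟪w - (k : ℂ) • x, (f : H)⟫_ℂ = ⟪x, S f⟫_ℂ := by
    intro f
    have h := congrArg (starRingEnd ℂ) (hweak f)
    simp only [_root_.map_add, _root_.map_mul, inner_conj_symm, Complex.conj_ofReal] at h
    rw [inner_sub_left, inner_smul_left, Complex.conj_ofReal]
    linear_combination -h
  have hxdom : x ∈ S.adjoint.domain := mem_adjoint_domain_of_exists x ⟨_, hadj⟩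
  refine ⟨⟨x, (mem_friedrichsExtension_domain hS).2 ⟨hxdom, u, hconv⟩⟩, ?_⟩
  rw [friedrichsExtension_apply hS _ hxdom, S.adjoint_apply_eq hS.dense ⟨x, hxdom⟩ hadj]
  simp

/-- A densely defined symmetric operator `A` such that `A + k` is surjective for a real `k` is
self-adjoint. -/
theorem isSelfAdjoint_of_surjective {A : H →ₗ.[ℂ] H} (hd : Dense (A.domain : Set H))
    (hsymm : ∀ x y : A.domain, ⟪A x, (y : H)⟫_ℂ = ⟪(x : H), A y⟫_ℂ) (k : ℝ)
    (hsurj : ∀ w, ∃ x : A.domain, A x + (k : ℂ) • (x : H) = w) : IsSelfAdjoint A := by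
  have hle : A ≤ A.adjoint := (show A.IsFormalAdjoint A from fun x y => hsymm x y).le_adjoint hd
  rw [isSelfAdjoint_def]
  symm
  refine eq_of_le_of_domain_eq hle (le_antisymm hle.1 fun y hy => ?_)
  -- As `(A + k) x = (A* + k) y`, the vector `y - x` is orthogonal to the range of `A + k`. This
  -- range is all of `H`, so testing against `(A + k) z = y - x` gives `y = x`.
  obtain ⟨x, hx⟩ := hsurj (A.adjoint ⟨y, hy⟩ + (k : ℂ) • y)
  obtain ⟨z, hz⟩ := hsurj (y - x)
  have h1 := A.adjoint_isFormalAdjoint hd ⟨y, hy⟩ z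
  have h2 := hsymm x z
  have h3 : ⟪A.adjoint ⟨y, hy⟩, (z : H)⟫_ℂ =
      ⟪A x + (k : ℂ) • (x : H) - (k : ℂ) • y, (z : H)⟫_ℂ := by
    rw [hx, add_sub_cancel_right]
  simp only [inner_sub_left, inner_add_left, inner_smul_left, Complex.conj_ofReal] at h3
  have h4 : ⟪y - (x : H), y - (x : H)⟫_ℂ = 0 := by
    nth_rewrite 2 [← hz]
    rw [inner_sub_left, inner_add_right, inner_add_right, inner_smul_right, inner_smul_right]
    simp only at h1
    linear_combination h3 - h1 + h2
  rw [inner_self_eq_zero, sub_eq_zero] at h4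
  rw [h4]
  exact x.2

theorem isSelfAdjoint_friedrichsExtension : IsSelfAdjoint (S.friedrichsExtension hS) := by
  obtain ⟨k, hk⟩ := exists_shift hS
  exact isSelfAdjoint_of_surjective (dense_friedrichsExtension_domain hS)
    (friedrichsExtension_inner_symm hS) k (exists_friedrichsExtension_add_eq hS hk)

end Friedrichs

end LinearPMap

namespace LinearPMap

variable {H : Type*} [NormedAddCommGroup H] [InnerProductSpace ℂ H]

/-! ### The spectrum of a self-adjoint operator -/

theorem mem_unboundedEigenspace {A : H →ₗ.[ℂ] H} {z : ℂ} {x : A.domain} :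
    x ∈ A.unboundedEigenspace z ↔ A x = z • (x : H) := by
  rw [unboundedEigenspace, LinearMap.mem_ker]
  exact sub_eq_zero

/-- An approximate eigenvalue belongs to the spectrum. -/
theorem mem_unboundedSpectrum_of_forall_exists {A : H →ₗ.[ℂ] H} {z : ℂ}
    (h : ∀ ε > 0, ∃ x : A.domain, (x : H) ≠ 0 ∧ ‖A x - z • (x : H)‖ ≤ ε * ‖(x : H)‖) :
    z ∈ A.unboundedSpectrum := by
  rintro ⟨R, -, hR⟩
  obtain ⟨x, hx, hxe⟩ := h (1 / (‖R‖ + 1)) (by positivity)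
  have h1 : ‖(x : H)‖ ≤ ‖R‖ * (1 / (‖R‖ + 1) * ‖(x : H)‖) := by
    calc ‖(x : H)‖ = ‖R (A x - z • (x : H))‖ := by rw [hR]
      _ ≤ ‖R‖ * ‖A x - z • (x : H)‖ := R.le_opNorm _
      _ ≤ _ := by gcongr
  have h2 : 0 < ‖(x : H)‖ := norm_pos_iff.2 hx
  have h3 : ‖R‖ * (1 / (‖R‖ + 1) * ‖(x : H)‖) = ‖(x : H)‖ - ‖(x : H)‖ / (‖R‖ + 1) := by
    field_simp
    ring
  have h4 : 0 < ‖(x : H)‖ / (‖R‖ + 1) := by positivity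
  linarith

section SelfAdjoint

variable [CompleteSpace H] {A : H →ₗ.[ℂ] H}

theorem inner_symm_of_isSelfAdjoint (hA : IsSelfAdjoint A) (x y : A.domain) :
    ⟪A x, (y : H)⟫_ℂ = ⟪(x : H), A y⟫_ℂ := by
  have h := A.adjoint_isFormalAdjoint hA.dense_domain
  rw [isSelfAdjoint_def.1 hA] at h
  exact h x y

theorem exists_eq_of_inner_eq (hA : IsSelfAdjoint A) {y w : H}
    (h : ∀ x : A.domain, ⟪w, (x : H)⟫_ℂ = ⟪y, A x⟫_ℂ) : ∃ hy : y ∈ A.domain, A ⟨y, hy⟩ = w := by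
  have h1 : y ∈ A.adjoint.domain := mem_adjoint_domain_of_exists y ⟨w, h⟩
  have h2 := A.adjoint_apply_eq hA.dense_domain ⟨y, h1⟩ h
  have hle : A.adjoint ≤ A := (isSelfAdjoint_def.1 hA).le
  exact ⟨hle.1 h1, (hle.2 (x := ⟨y, h1⟩) (y := ⟨y, hle.1 h1⟩) rfl).symm.trans h2⟩

/-- A self-adjoint operator is closed: the symmetry relation survives the limit and places `x` in
the domain of the adjoint. -/
theorem exists_eq_of_tendsto (hA : IsSelfAdjoint A) {u : ℕ → A.domain} {x y : H}
    (hu : Tendsto (fun n => (u n : H)) atTop (𝓝 x)) (hAu : Tendsto (fun n => A (u n)) atTop (𝓝 y)) :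
    ∃ hx : x ∈ A.domain, A ⟨x, hx⟩ = y := by
  refine exists_eq_of_inner_eq hA fun v => ?_
  refine tendsto_nhds_unique (hAu.inner tendsto_const_nhds) ?_
  simp only [inner_symm_of_isSelfAdjoint hA]
  exact hu.inner tendsto_const_nhds

theorem im_inner_self_of_isSelfAdjoint (hA : IsSelfAdjoint A) (x : A.domain) :
    (⟪(x : H), A x⟫_ℂ).im = 0 := by
  rw [← Complex.conj_eq_iff_im, inner_conj_symm, inner_symm_of_isSelfAdjoint hA]

/-- The lower bound makes `A - z` injective with closed range and bounds its inverse. The orthogonal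
complement of the range is the kernel of `A - conj z`, which `hker` makes trivial. -/
theorem isResolventPoint_of_le_norm (hA : IsSelfAdjoint A) {z : ℂ} {c : ℝ} (hc : 0 < c)
    (hb : ∀ x : A.domain, c * ‖(x : H)‖ ≤ ‖A x - z • (x : H)‖)
    (hker : ∀ x : A.domain, A x = (starRingEnd ℂ) z • (x : H) → (x : H) = 0) :
    A.IsResolventPoint z := by
  set T : A.domain →ₗ[ℂ] H := A.toFun - z • A.domain.subtype with hT
  have hTx : ∀ x, T x = A x - z • (x : H) := fun x => rfl
  have hclosed : _root_.IsClosed (LinearMap.range T : Set H) := by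
    refine IsSeqClosed.isClosed fun y w hy hw => ?_
    choose x hx using hy
    have hdist : ∀ n m, dist (x n : H) (x m) ≤ c⁻¹ * dist (y n) (y m) := by
      intro n m
      have h := hb (x n - x m)
      rw [← hTx, _root_.map_sub, hx, hx] at h
      rw [dist_eq_norm, dist_eq_norm, ← div_eq_inv_mul, le_div_iff₀ hc, mul_comm]
      exact h
    have hcau : CauchySeq fun n => (x n : H) := by
      rw [cauchySeq_iff_tendsto_dist_atTop_0]
      have h := (cauchySeq_iff_tendsto_dist_atTop_0.1 hw.cauchySeq).const_mul c⁻¹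
      rw [mul_zero] at h
      exact squeeze_zero (fun _ => dist_nonneg) (fun p => hdist _ _) h
    obtain ⟨a, ha⟩ := cauchySeq_tendsto_of_complete hcau
    have hAx : Tendsto (fun n => A (x n)) atTop (𝓝 (w + z • a)) := by
      refine (hw.add (ha.const_smul z)).congr fun n => ?_
      rw [← hx, hTx, sub_add_cancel]
    obtain ⟨had, hAa⟩ := exists_eq_of_tendsto hA ha hAx
    refine ⟨⟨a, had⟩, ?_⟩
    rw [hTx, hAa, add_sub_cancel_right]
  have horth : (LinearMap.range T)ᗮ = ⊥ := by
    rw [Submodule.eq_bot_iff]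
    intro y hy
    have h : ∀ x : A.domain, ⟪(starRingEnd ℂ) z • y, (x : H)⟫_ℂ = ⟪y, A x⟫_ℂ := by
      intro x
      have h := (Submodule.mem_orthogonal' _ _).1 hy (T x) (LinearMap.mem_range_self _ _)
      rw [hTx, inner_sub_right, inner_smul_right, sub_eq_zero] at h
      rw [inner_smul_left, RCLike.conj_conj, h]
    obtain ⟨hy', hy''⟩ := exists_eq_of_inner_eq hA h
    exact hker ⟨y, hy'⟩ hy''
  have hsurj : Function.Surjective T := by
    rw [← LinearMap.range_eq_top]
    have : CompleteSpace (LinearMap.range T) := hclosed.completeSpace_coe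
    exact Submodule.orthogonal_eq_bot_iff.1 horth
  have hinj : Function.Injective T := by
    rw [← LinearMap.ker_eq_bot, Submodule.eq_bot_iff]
    intro x hx
    have h := hb x
    rw [← hTx, LinearMap.mem_ker.1 hx, norm_zero] at h
    have : ‖(x : H)‖ = 0 := le_antisymm (by nlinarith [norm_nonneg (x : H)]) (norm_nonneg _)
    exact Subtype.ext (norm_eq_zero.1 this)
  set e := LinearEquiv.ofBijective T ⟨hinj, hsurj⟩ with he
  have heT : ∀ x, e x = A x - z • (x : H) := fun x => rfl
  refine ⟨(A.domain.subtype.comp e.symm.toLinearMap).mkContinuous c⁻¹ fun y => ?_,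
    fun y => ⟨(e.symm y).2, ?_⟩, fun x => ?_⟩
  · have h := hb (e.symm y)
    rw [← heT, e.apply_symm_apply] at h
    rw [← div_eq_inv_mul, le_div_iff₀ hc, mul_comm]
    exact h
  · exact (heT (e.symm y)).symm.trans (e.apply_symm_apply y)
  · exact congrArg Subtype.val (e.symm_apply_apply x)

/-- Since `⟨x, A x⟩` is real, the imaginary part of `⟨x, (A - w) x⟩` is `-(Im w) ‖x‖²`. This yields
the lower bound at `z`, and at its conjugate the triviality of the kernel. -/
theorem im_eq_zero_of_mem_unboundedSpectrum (hA : IsSelfAdjoint A) {z : ℂ}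
    (hz : z ∈ A.unboundedSpectrum) : z.im = 0 := by
  by_contra hne
  have key : ∀ (w : ℂ) (x : A.domain), |w.im| * ‖(x : H)‖ ≤ ‖A x - w • (x : H)‖ := by
    intro w x
    rcases (norm_nonneg (x : H)).eq_or_lt with h0 | h0
    · rw [← h0, mul_zero]
      exact norm_nonneg _
    have e : ⟪(x : H), A x - w • (x : H)⟫_ℂ = ⟪(x : H), A x⟫_ℂ - w * ((‖(x : H)‖ ^ 2 : ℝ) : ℂ) := by
      rw [inner_sub_right, inner_smul_right, inner_self_eq_norm_sq_to_K]
      simp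
    have e2 : (⟪(x : H), A x - w • (x : H)⟫_ℂ).im = -(w.im * ‖(x : H)‖ ^ 2) := by
      rw [e, Complex.sub_im, im_inner_self_of_isSelfAdjoint hA, Complex.im_mul_ofReal, zero_sub]
    have h1 := (Complex.abs_im_le_norm _).trans
      (norm_inner_le_norm (𝕜 := ℂ) (x : H) (A x - w • (x : H)))
    rw [e2, abs_neg, abs_mul, abs_of_nonneg (sq_nonneg ‖(x : H)‖)] at h1
    nlinarith
  refine hz (isResolventPoint_of_le_norm hA (abs_pos.2 hne) (key z) fun x hx => ?_)
  have h := key ((starRingEnd ℂ) z) x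
  rw [hx, sub_self, norm_zero, Complex.conj_im, abs_neg] at h
  have : ‖(x : H)‖ = 0 :=
    le_antisymm (by nlinarith [norm_nonneg (x : H), abs_pos.2 hne]) (norm_nonneg _)
  exact norm_eq_zero.1 this

theorem inner_eq_zero_of_eigenvalue_ne (hA : IsSelfAdjoint A) {a b : ℝ} (hab : a ≠ b)
    {x y : A.domain} (hx : A x = (a : ℂ) • (x : H)) (hy : A y = (b : ℂ) • (y : H)) :
    ⟪(x : H), (y : H)⟫_ℂ = 0 := by
  have h := inner_symm_of_isSelfAdjoint hA x y
  rw [hx, hy, inner_smul_left, inner_smul_right, Complex.conj_ofReal, ← sub_eq_zero, ← sub_mul,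
    mul_eq_zero, sub_eq_zero] at h
  exact h.resolve_left fun h' => hab (by exact_mod_cast h')

/-- A real point of the spectrum is an approximate eigenvalue. -/
theorem exists_approximate_eigenvector (hA : IsSelfAdjoint A) {a : ℝ}
    (ha : (a : ℂ) ∈ A.unboundedSpectrum) :
    ∃ u : ℕ → A.domain, (∀ n, ‖(u n : H)‖ = 1) ∧
      Tendsto (fun n => A (u n) - (a : ℂ) • (u n : H)) atTop (𝓝 0) := by
  have hex : ∀ n : ℕ, ∃ u : A.domain, ‖(u : H)‖ = 1 ∧
      ‖A u - (a : ℂ) • (u : H)‖ ≤ 1 / ((n : ℝ) + 1) := by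
    intro n
    by_contra! hcon
    have hpos : 0 < 1 / ((n : ℝ) + 1) := Nat.one_div_pos_of_nat
    have hb : ∀ x : A.domain, 1 / ((n : ℝ) + 1) * ‖(x : H)‖ ≤ ‖A x - (a : ℂ) • (x : H)‖ := by
      intro x
      rcases (norm_nonneg (x : H)).eq_or_lt with h0 | h0
      · rw [← h0, mul_zero]
        exact norm_nonneg _
      set t : ℂ := ((‖(x : H)‖⁻¹ : ℝ) : ℂ) with ht
      have hnt : ‖t‖ = ‖(x : H)‖⁻¹ := by
        rw [ht, Complex.norm_real, Real.norm_of_nonneg (by positivity)]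
      have h1 : ‖((t • x : A.domain) : H)‖ = 1 := by
        rw [Submodule.coe_smul, norm_smul, hnt, inv_mul_cancel₀ h0.ne']
      have h2 := (hcon (t • x) h1).le
      rw [LinearPMap.map_smul, Submodule.coe_smul, smul_comm _ t, ← smul_sub, norm_smul, hnt,
        ← div_eq_inv_mul, le_div_iff₀ h0] at h2
      exact h2
    refine ha (isResolventPoint_of_le_norm hA hpos hb fun x hx => ?_)
    have h := hb x
    rw [hx, Complex.conj_ofReal, sub_self, norm_zero] at h
    have : ‖(x : H)‖ = 0 := le_antisymm (by nlinarith [norm_nonneg (x : H)]) (norm_nonneg _)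
    exact norm_eq_zero.1 this
  choose u hu hu' using hex
  exact ⟨u, hu, squeeze_zero_norm hu' tendsto_one_div_add_atTop_nhds_zero_nat⟩

/-- `A` is, for every `ε > 0`, bounded below by `-ε` up to a form of finite rank. -/
def IsFormBoundedBelowModFiniteRank (A : H →ₗ.[ℂ] H) : Prop :=
  ∀ ε > 0, ∃ (N : ℕ) (g : Fin N → H), ∀ x : A.domain,
    -ε * ‖(x : H)‖ ^ 2 - ∑ i, ‖⟪g i, (x : H)⟫_ℂ‖ ^ 2 ≤ (⟪(x : H), A x⟫_ℂ).re

/-- The compactness argument. With `ε = -a/2` the form of `A - a` is at least `(-a/2) ‖w‖²` minus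
the finite-rank part. Along a subsequence the finitely many coefficients `⟨g i, u n⟩` converge, so
the bound applied to differences makes the subsequence Cauchy. Closedness of `A` identifies the
limit, which may be zero because only `‖u n‖ ≤ 1` is required. -/
theorem exists_eigenvector_of_tendsto (hA : IsSelfAdjoint A)
    (hG : A.IsFormBoundedBelowModFiniteRank) {a : ℝ} (ha : a < 0) {u : ℕ → A.domain}
    (hu : ∀ n, ‖(u n : H)‖ ≤ 1)
    (hAu : Tendsto (fun n => A (u n) - (a : ℂ) • (u n : H)) atTop (𝓝 0)) :
    ∃ (x : A.domain) (φ : ℕ → ℕ), StrictMono φ ∧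
      Tendsto (fun n => (u (φ n) : H)) atTop (𝓝 (x : H)) ∧ A x = (a : ℂ) • (x : H) := by
  obtain ⟨N, g, hg⟩ := hG (-a / 2) (by linarith)
  have hbdd : ∀ n, (fun i => ⟪g i, (u n : H)⟫_ℂ) ∈
      Metric.closedBall (0 : Fin N → ℂ) (∑ i, ‖g i‖) := by
    intro n
    rw [mem_closedBall_zero_iff,
      pi_norm_le_iff_of_nonneg (Finset.sum_nonneg fun i _ => norm_nonneg _)]
    intro i
    calc ‖⟪g i, (u n : H)⟫_ℂ‖ ≤ ‖g i‖ * ‖(u n : H)‖ := norm_inner_le_norm _ _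
      _ ≤ ‖g i‖ * 1 := by gcongr; exact hu n
      _ ≤ ∑ i, ‖g i‖ := by
        rw [mul_one]
        exact Finset.single_le_sum (f := fun i => ‖g i‖) (fun i _ => norm_nonneg _)
          (Finset.mem_univ i)
  obtain ⟨l, -, φ, hφ, hl⟩ := tendsto_subseq_of_bounded Metric.isBounded_closedBall hbdd
  rw [tendsto_pi_nhds] at hl
  have hAφ := hAu.comp hφ.tendsto_atTop
  have fst : Tendsto (Prod.fst : ℕ × ℕ → ℕ) atTop atTop := by
    rw [← prod_atTop_atTop_eq]; exact tendsto_fst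
  have snd : Tendsto (Prod.snd : ℕ × ℕ → ℕ) atTop atTop := by
    rw [← prod_atTop_atTop_eq]; exact tendsto_snd
  have hmaj : Tendsto (fun p : ℕ × ℕ =>
      2 * ‖(A (u (φ p.1)) - (a : ℂ) • (u (φ p.1) : H)) -
        (A (u (φ p.2)) - (a : ℂ) • (u (φ p.2) : H))‖
        + ∑ i, ‖⟪g i, (u (φ p.1) : H)⟫_ℂ - ⟪g i, (u (φ p.2) : H)⟫_ℂ‖ ^ 2) atTop (𝓝 0) := by
    have h1 := (((hAφ.comp fst).sub (hAφ.comp snd)).norm).const_mul 2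
    have h2 : Tendsto (fun p : ℕ × ℕ =>
        ∑ i, ‖⟪g i, (u (φ p.1) : H)⟫_ℂ - ⟪g i, (u (φ p.2) : H)⟫_ℂ‖ ^ 2) atTop
        (𝓝 (∑ i, ‖l i - l i‖ ^ 2)) :=
      tendsto_finsetSum _ fun i _ => ((((hl i).comp fst).sub ((hl i).comp snd)).norm).pow 2
    simpa using h1.add h2
  have hest : ∀ p : ℕ × ℕ, (-a / 2) * ‖(u (φ p.1) : H) - u (φ p.2)‖ ^ 2 ≤
      2 * ‖(A (u (φ p.1)) - (a : ℂ) • (u (φ p.1) : H)) -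
        (A (u (φ p.2)) - (a : ℂ) • (u (φ p.2) : H))‖
        + ∑ i, ‖⟪g i, (u (φ p.1) : H)⟫_ℂ - ⟪g i, (u (φ p.2) : H)⟫_ℂ‖ ^ 2 := by
    intro p
    set w : A.domain := u (φ p.1) - u (φ p.2) with hw
    have hwn : ‖(w : H)‖ ≤ 2 := by
      rw [hw, Submodule.coe_sub]
      exact (norm_sub_le _ _).trans (by linarith [hu (φ p.1), hu (φ p.2)])
    have e1 : (A (u (φ p.1)) - (a : ℂ) • (u (φ p.1) : H)) -
        (A (u (φ p.2)) - (a : ℂ) • (u (φ p.2) : H)) = A w - (a : ℂ) • (w : H) := by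
      rw [hw, LinearPMap.map_sub, Submodule.coe_sub, smul_sub]
      abel
    have e2 : (u (φ p.1) : H) - u (φ p.2) = w := rfl
    have h1 := hg w
    have h2 : (⟪(w : H), A w - (a : ℂ) • (w : H)⟫_ℂ).re =
        (⟪(w : H), A w⟫_ℂ).re - a * ‖(w : H)‖ ^ 2 := by
      have : (⟪(w : H), (w : H)⟫_ℂ).re = ‖(w : H)‖ ^ 2 := inner_self_eq_norm_sq (𝕜 := ℂ) (w : H)
      rw [inner_sub_right, inner_smul_right, Complex.sub_re, Complex.re_ofReal_mul, this]
    have h3 : (⟪(w : H), A w - (a : ℂ) • (w : H)⟫_ℂ).re ≤ ‖(w : H)‖ * ‖A w - (a : ℂ) • (w : H)‖ :=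
      re_inner_le_norm (𝕜 := ℂ) _ _
    have h4 : ‖(w : H)‖ * ‖A w - (a : ℂ) • (w : H)‖ ≤ 2 * ‖A w - (a : ℂ) • (w : H)‖ := by gcongr
    simp only [← inner_sub_right, e1, e2]
    linarith
  have hsq : Tendsto (fun p : ℕ × ℕ => ‖(u (φ p.1) : H) - u (φ p.2)‖ ^ 2) atTop (𝓝 0) := by
    have h := hmaj.const_mul (-a / 2)⁻¹
    rw [mul_zero] at h
    refine squeeze_zero (fun _ => sq_nonneg _) (fun p => ?_) h
    rw [← div_eq_inv_mul, le_div_iff₀ (by linarith), mul_comm]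
    exact hest p
  have hcau : CauchySeq fun n => (u (φ n) : H) := by
    rw [cauchySeq_iff_tendsto_dist_atTop_0]
    have := hsq.sqrt
    simpa [Real.sqrt_sq (norm_nonneg _), dist_eq_norm] using this
  obtain ⟨x, hx⟩ := cauchySeq_tendsto_of_complete hcau
  have hAx : Tendsto (fun n => A (u (φ n))) atTop (𝓝 ((a : ℂ) • x)) := by
    have h := hAφ.add (hx.const_smul (a : ℂ))
    simpa using h
  obtain ⟨hxd, hxA⟩ := exists_eq_of_tendsto hA hx hAx
  exact ⟨⟨x, hxd⟩, φ, hφ, hx, hxA⟩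

theorem exists_unit_eigenvector (hA : IsSelfAdjoint A) (hG : A.IsFormBoundedBelowModFiniteRank)
    {a : ℝ} (ha : a < 0) (hspec : (a : ℂ) ∈ A.unboundedSpectrum) :
    ∃ x : A.domain, ‖(x : H)‖ = 1 ∧ A x = (a : ℂ) • (x : H) := by
  obtain ⟨u, hu, hAu⟩ := exists_approximate_eigenvector hA hspec
  obtain ⟨x, φ, -, hx, hxA⟩ := exists_eigenvector_of_tendsto hA hG ha (fun n => (hu n).le) hAu
  refine ⟨x, tendsto_nhds_unique hx.norm ?_, hxA⟩
  simp only [hu]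
  exact tendsto_const_nhds

/-- By Riesz's theorem it suffices that the unit ball of the eigenspace is compact; sequences of
eigenvectors in it satisfy the preceding criterion trivially. -/
theorem finiteDimensional_unboundedEigenspace (hA : IsSelfAdjoint A)
    (hG : A.IsFormBoundedBelowModFiniteRank) {a : ℝ} (ha : a < 0) :
    FiniteDimensional ℂ (A.unboundedEigenspace a) := by
  refine FiniteDimensional.of_isCompact_closedBall₀ ℂ zero_lt_one ?_
  refine IsSeqCompact.isCompact fun v hv => ?_
  have hn : ∀ n, ‖((v n : A.domain) : H)‖ ≤ 1 := fun n => mem_closedBall_zero_iff.1 (hv n)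
  have h0 : Tendsto (fun n => A (v n : A.domain) - (a : ℂ) • ((v n : A.domain) : H)) atTop (𝓝 0) := by
    simp only [mem_unboundedEigenspace.1 (v _).2, sub_self]
    exact tendsto_const_nhds
  obtain ⟨x, φ, hφ, hx, hxA⟩ := exists_eigenvector_of_tendsto hA hG ha hn h0
  refine ⟨⟨x, mem_unboundedEigenspace.2 hxA⟩, ?_, φ, hφ, ?_⟩
  · exact mem_closedBall_zero_iff.2 (le_of_tendsto hx.norm (Eventually.of_forall fun n => hn _))
  · rw [tendsto_subtype_rng, tendsto_subtype_rng]
    exact hx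

/-- If spectral points `b n ≠ a` converged to `a`, they would have unit eigenvectors, a subsequence
of which converges to a unit eigenvector for `a`. That limit is orthogonal to each of them, hence to
itself. -/
theorem isolated_of_neg (hA : IsSelfAdjoint A) (hG : A.IsFormBoundedBelowModFiniteRank)
    {a : ℝ} (ha : a < 0) :
    ∃ ε > 0, ∀ w ∈ A.unboundedSpectrum, dist w (a : ℂ) < ε → w = a := by
  by_contra! hcon
  have hex : ∀ n : ℕ, ∃ (b : ℝ) (x : A.domain), |b - a| < 1 / ((n : ℝ) + 1) ∧ b ≠ a ∧
      ‖(x : H)‖ = 1 ∧ A x = (b : ℂ) • (x : H) := by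
    intro n
    -- Staying within `-a` of `a` keeps the spectral point negative, so that it is an eigenvalue.
    obtain ⟨w, hw, hd, hne⟩ := hcon (min (1 / ((n : ℝ) + 1)) (-a))
      (lt_min Nat.one_div_pos_of_nat (by linarith))
    have hwre : w = (w.re : ℂ) :=
      Complex.ext rfl (by simp [im_eq_zero_of_mem_unboundedSpectrum hA hw])
    rw [hwre, Complex.dist_eq, ← Complex.ofReal_sub, Complex.norm_real, Real.norm_eq_abs,
      lt_min_iff] at hd
    rw [hwre] at hw
    obtain ⟨x, hx, hxA⟩ := exists_unit_eigenvector hA hG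
      (by linarith [(abs_lt.1 hd.2).2]) hw
    exact ⟨w.re, x, hd.1, fun h => hne (by rw [hwre, h]), hx, hxA⟩
  choose b u hb hba hu hAu using hex
  have h0 : Tendsto (fun n => A (u n) - (a : ℂ) • (u n : H)) atTop (𝓝 0) := by
    refine squeeze_zero_norm (fun n => ?_) tendsto_one_div_add_atTop_nhds_zero_nat
    rw [hAu, ← sub_smul, norm_smul, hu, mul_one, ← Complex.ofReal_sub, Complex.norm_real]
    exact (hb n).le
  obtain ⟨x, φ, hφ, hx, hxA⟩ := exists_eigenvector_of_tendsto hA hG ha (fun n => (hu n).le) h0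
  have hx1 : ‖(x : H)‖ = 1 := by
    refine tendsto_nhds_unique hx.norm ?_
    simp only [hu]
    exact tendsto_const_nhds
  have hxx : ⟪(x : H), (x : H)⟫_ℂ = 0 := by
    refine tendsto_nhds_unique (hx.inner tendsto_const_nhds) ?_
    simp only [inner_eq_zero_of_eigenvalue_ne hA (hba _) (hAu _) hxA]
    exact tendsto_const_nhds
  rw [inner_self_eq_zero] at hxx
  rw [hxx, norm_zero] at hx1
  exact zero_ne_one hx1

/-- If the form of a self-adjoint operator is nonnegative up to small errors and forms of finite
rank, and the spectrum contains `[0, ∞)`, then the essential spectrum is `[0, ∞)`. -/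
theorem essentialSpectrum_eq_of_isFormBoundedBelowModFiniteRank (hA : IsSelfAdjoint A)
    (hG : A.IsFormBoundedBelowModFiniteRank)
    (hpos : ∀ r : ℝ, 0 ≤ r → (r : ℂ) ∈ A.unboundedSpectrum) :
    A.essentialSpectrum = (fun r : ℝ => (r : ℂ)) '' Ici (0 : ℝ) := by
  ext z
  constructor
  · rintro ⟨hz, hzd⟩
    have hzre : z = (z.re : ℂ) :=
      Complex.ext rfl (by simp [im_eq_zero_of_mem_unboundedSpectrum hA hz])
    refine ⟨z.re, ?_, hzre.symm⟩
    by_contra hneg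
    rw [mem_Ici, not_le] at hneg
    rw [hzre] at hz hzd
    refine hzd ⟨hz, isolated_of_neg hA hG hneg, ?_,
      finiteDimensional_unboundedEigenspace hA hG hneg⟩
    obtain ⟨x, hx, hxA⟩ := exists_unit_eigenvector hA hG hneg hz
    intro hbot
    have hmem := mem_unboundedEigenspace.2 hxA
    rw [hbot, Submodule.mem_bot] at hmem
    rw [hmem, Submodule.coe_zero, norm_zero] at hx
    exact zero_ne_one hx
  · rintro ⟨r, hr, rfl⟩
    refine ⟨hpos r hr, fun ⟨_, ⟨ε, hε, hiso⟩, _⟩ => ?_⟩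
    have h := hiso ((r + ε / 2 : ℝ) : ℂ) (hpos _ (by linarith [mem_Ici.1 hr])) (by
      rw [Complex.dist_eq, ← Complex.ofReal_sub, Complex.norm_real, Real.norm_eq_abs,
        add_sub_cancel_left, abs_of_pos (by linarith)]
      linarith)
    have h' : r + ε / 2 = r := Complex.ofReal_injective h
    linarith

end SelfAdjoint

section Friedrichs

variable [CompleteSpace H] {S : H →ₗ.[ℂ] H} (hS : S.IsSemibounded)

/-- The norm and the finite-rank part are continuous on `H`, and the form converges along the
sequence of `exists_tendsto_quadForm`. -/
theorem isFormBoundedBelowModFiniteRank_friedrichsExtension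
    (hG : ∀ ε > 0, ∃ (N : ℕ) (g : Fin N → H), ∀ x : S.domain,
      -ε * ‖(x : H)‖ ^ 2 - ∑ i, ‖⟪g i, (x : H)⟫_ℂ‖ ^ 2 ≤ S.quadForm x) :
    (S.friedrichsExtension hS).IsFormBoundedBelowModFiniteRank := by
  intro ε hε
  obtain ⟨N, g, hg⟩ := hG ε hε
  refine ⟨N, g, fun x => ?_⟩
  obtain ⟨u, hu, hq⟩ := exists_tendsto_quadForm hS x
  refine le_of_tendsto_of_tendsto' (((hu.norm.pow 2).const_mul (-ε)).sub
    (tendsto_finsetSum Finset.univ fun i _ =>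
      ((tendsto_const_nhds (x := g i)).inner hu).norm.pow 2)) hq fun n => hg (u n)

end Friedrichs

end LinearPMap

namespace HalfLine

/-! ### Test functions and the quadratic form -/

/-! ### Functions supported in a compact subset of the half-line -/

section Support

variable {E : Type*} [NormedAddCommGroup E] {a b : ℝ} {F F' : ℝ → E}

theorem eventuallyEq_zero_of_notMem_Icc (h0 : ∀ s ∉ Icc a b, F s = 0) {s : ℝ} (hs : s ∉ Icc a b) :
    F =ᶠ[𝓝 s] 0 :=
  Filter.eventually_of_mem (isClosed_Icc.isOpen_compl.mem_nhds hs) h0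

theorem integrable_of_continuousOn (ha : 0 < a) (hc : ContinuousOn F (Ioi 0))
    (h0 : ∀ s ∉ Icc a b, F s = 0) : Integrable F halfMeasure := by
  have hsub : Icc a b ⊆ Ioi 0 := fun s hs => lt_of_lt_of_le ha hs.1
  exact ((hc.mono hsub).integrableOn_compact isCompact_Icc).of_forall_sdiff_eq_zero
    measurableSet_Ioi fun s hs => h0 s hs.2

variable [NormedSpace ℝ E]

/-- Vanishing off `[a, b]` with `a > 0` removes both boundary terms. Regularity is only required on
`(0, ∞)`, so weights singular at `0` are allowed. -/
theorem integral_deriv_eq_zero (ha : 0 < a) (hF : ∀ s ∈ Ioi (0 : ℝ), HasDerivAt F (F' s) s)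
    (hc : ContinuousOn F' (Ioi 0)) (h0 : ∀ s ∉ Icc a b, F s = 0) :
    ∫ s, F' s ∂halfMeasure = 0 := by
  have h0' : ∀ s ∉ Icc a b, s ∈ Ioi (0 : ℝ) → F' s = 0 := fun s hs hpos =>
    (hF s hpos).unique (((hasDerivAt_const s (0 : E))).congr_of_eventuallyEq
      (eventuallyEq_zero_of_notMem_Icc h0 hs))
  have hzero : (0 : ℝ) ∉ Icc a b := fun h => absurd h.1 (not_le.2 ha)
  have hsub : Icc a b ⊆ Ioi 0 := fun s hs => lt_of_lt_of_le ha hs.1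
  have hint : IntegrableOn F' (Ioi 0) :=
    ((hc.mono hsub).integrableOn_compact isCompact_Icc).of_forall_sdiff_eq_zero
      measurableSet_Ioi fun s hs => h0' s hs.2 hs.1
  have hcont : ContinuousWithinAt F (Ici 0) 0 :=
    (continuousAt_const.congr (eventuallyEq_zero_of_notMem_Icc h0 hzero).symm).continuousWithinAt
  have hlim : Tendsto F atTop (𝓝 0) := by
    refine tendsto_const_nhds.congr' ?_
    filter_upwards [eventually_gt_atTop b] with s hs
    exact (h0 s fun h => absurd h.2 (not_le.2 hs)).symm
  by_cases hE : CompleteSpace E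
  · rw [integral_Ioi_of_hasDerivAt_of_tendsto hcont hF hint hlim, h0 0 hzero, sub_zero]
  -- In an incomplete space the Bochner integral is zero by convention.
  · simp [integral, hE]

theorem deriv_eq_zero_of_notMem_Icc (h0 : ∀ s ∉ Icc a b, F s = 0) :
    ∀ s ∉ Icc a b, deriv F s = 0 := fun s hs => by
  rw [(eventuallyEq_zero_of_notMem_Icc h0 hs).deriv_eq]
  exact deriv_const s 0

end Support

theorem exists_Icc (f : Test) : ∃ a b : ℝ, 0 < a ∧ ∀ s ∉ Icc a b, f s = 0 := by
  have hK : IsCompact (tsupport (f : ℝ → ℂ)) := f.hasCompactSupport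
  rcases (tsupport (f : ℝ → ℂ)).eq_empty_or_nonempty with he | hne
  · exact ⟨1, 1, one_pos, fun s _ => image_eq_zero_of_notMem_tsupport (by rw [he]; simp)⟩
  · obtain ⟨a, ha, hle⟩ := hK.exists_isLeast hne
    obtain ⟨b, -, hge⟩ := hK.exists_isGreatest hne
    exact ⟨a, b, f.tsupport_subset ha, fun s hs => image_eq_zero_of_notMem_tsupport fun hs' =>
      hs ⟨hle hs', hge hs'⟩⟩

theorem exists_Icc₂ (f g : Test) :
    ∃ a b : ℝ, 0 < a ∧ (∀ s ∉ Icc a b, f s = 0) ∧ ∀ s ∉ Icc a b, g s = 0 := by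
  obtain ⟨a, b, ha, hf⟩ := exists_Icc f
  obtain ⟨a', b', ha', hg⟩ := exists_Icc g
  exact ⟨min a a', max b b', lt_min ha ha',
    fun s hs => hf s fun h => hs ⟨min_le_of_left_le h.1, le_max_of_le_left h.2⟩,
    fun s hs => hg s fun h => hs ⟨min_le_of_right_le h.1, le_max_of_le_right h.2⟩⟩

theorem hasDerivAt_test (f : Test) (s : ℝ) : HasDerivAt f (deriv f s) s :=
  ((test_contDiff f).differentiable (by norm_num) s).hasDerivAt

theorem hasDerivAt_deriv_test (f : Test) (s : ℝ) :
    HasDerivAt (deriv (f : ℝ → ℂ)) (deriv (deriv f) s) s :=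
  ((test_contDiff_deriv f).differentiable (by norm_num) s).hasDerivAt

theorem continuous_deriv_test (f : Test) : Continuous (deriv (f : ℝ → ℂ)) :=
  (test_contDiff_deriv f).continuous

theorem continuous_deriv_deriv_test (f : Test) : Continuous (deriv (deriv (f : ℝ → ℂ))) :=
  (test_contDiff_deriv f).continuous_deriv (by norm_num)

theorem coeFn_testToL2 (f : Test) : testToL2 f =ᵐ[halfMeasure] f := (memLp_test f).coeFn_toLp

theorem coeFn_diffExprToL2 (d : ℕ) (q μ : ℝ) (f : Test) :
    diffExprToL2 d q μ f =ᵐ[halfMeasure] diffExpr d q μ f := (memLp_diffExpr d q μ f).coeFn_toLp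

theorem continuousOn_ofReal_potential (d : ℕ) (q μ : ℝ) :
    ContinuousOn (fun s => (potential d q μ s : ℂ)) (Ioi 0) :=
  Complex.continuous_ofReal.comp_continuousOn (continuousOn_potential d q μ)

/-- Integration by parts: the two integrands differ by the derivative of `conj f · g'`. -/
theorem inner_testToL2_diffExprToL2 (d : ℕ) (q μ : ℝ) (f g : Test) :
    ⟪testToL2 f, diffExprToL2 d q μ g⟫_ℂ = ∫ s, (starRingEnd ℂ (deriv f s) * deriv g s +
      (potential d q μ s : ℂ) * (starRingEnd ℂ (f s) * g s)) ∂halfMeasure := by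
  obtain ⟨a, b, ha, hf, hg⟩ := exists_Icc₂ f g
  have hf' := deriv_eq_zero_of_notMem_Icc hf
  have cf := f.continuous
  have cg := g.continuous
  have cf' := continuous_deriv_test f
  have cg' := continuous_deriv_test g
  have cg'' := continuous_deriv_deriv_test g
  have e1 : ⟪testToL2 f, diffExprToL2 d q μ g⟫_ℂ =
      ∫ s, starRingEnd ℂ (f s) * diffExpr d q μ g s ∂halfMeasure := by
    rw [L2.inner_def]
    refine integral_congr_ae ?_
    filter_upwards [coeFn_testToL2 f, coeFn_diffExprToL2 d q μ g] with s h1 h2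
    rw [h1, h2, RCLike.inner_apply, mul_comm]
  have hibp : ∫ s, (starRingEnd ℂ (deriv f s) * deriv g s + starRingEnd ℂ (f s) *
      deriv (deriv g) s) ∂halfMeasure = 0 := by
    refine integral_deriv_eq_zero (F := fun s => starRingEnd ℂ (f s) * deriv g s) (b := b) ha
      (fun s _ => ?_) ?_ fun s hs => ?_
    · exact (hasDerivAt_test f s).star.mul (hasDerivAt_deriv_test g s)
    · exact (by fun_prop : Continuous _).continuousOn
    · rw [hf s hs, map_zero, zero_mul]
  have i1 : Integrable (fun s => starRingEnd ℂ (deriv f s) * deriv g s + starRingEnd ℂ (f s) *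
      deriv (deriv g) s) halfMeasure :=
    integrable_of_continuousOn (b := b) ha (by fun_prop : Continuous _).continuousOn
      fun s hs => by rw [hf s hs, hf' s hs]; simp
  have i2 : Integrable (fun s => starRingEnd ℂ (deriv f s) * deriv g s +
      (potential d q μ s : ℂ) * (starRingEnd ℂ (f s) * g s)) halfMeasure :=
    integrable_of_continuousOn (b := b) ha
      ((by fun_prop : Continuous _).continuousOn.add ((continuousOn_ofReal_potential d q μ).mul
        (by fun_prop : Continuous _).continuousOn))
      fun s hs => by rw [hf s hs, hf' s hs]; simp
  rw [e1]
  calc _ = ∫ s, ((starRingEnd ℂ (deriv f s) * deriv g s +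
        (potential d q μ s : ℂ) * (starRingEnd ℂ (f s) * g s)) -
        (starRingEnd ℂ (deriv f s) * deriv g s + starRingEnd ℂ (f s) * deriv (deriv g) s))
          ∂halfMeasure := by
        congr 1 with s
        simp only [diffExpr]
        ring
    _ = _ := by rw [integral_sub i2 i1, hibp, sub_zero]

theorem exists_test_eq {d : ℕ} {q μ : ℝ} (x : (minimalOperator d q μ).domain) :
    ∃ f : Test, (x : L2) = testToL2 f ∧ minimalOperator d q μ x = diffExprToL2 d q μ f := by
  obtain ⟨_, f, rfl⟩ := x
  exact ⟨f, rfl, minimalOperator_apply d q μ f⟩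

theorem minimalOperator_symm (d : ℕ) (q μ : ℝ) (x y : (minimalOperator d q μ).domain) :
    ⟪minimalOperator d q μ x, (y : L2)⟫_ℂ = ⟪(x : L2), minimalOperator d q μ y⟫_ℂ := by
  obtain ⟨f, hf, hf'⟩ := exists_test_eq x
  obtain ⟨g, hg, hg'⟩ := exists_test_eq y
  rw [hf, hf', hg, hg', ← inner_conj_symm, inner_testToL2_diffExprToL2,
    inner_testToL2_diffExprToL2, ← integral_conj]
  congr 1 with s
  simp only [map_add, map_mul, Complex.conj_conj, Complex.conj_ofReal]
  ring

/-- A function orthogonal to all real test functions vanishes almost everywhere, by the fundamental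
lemma of the calculus of variations. -/
theorem dense_range_testToL2 : Dense (LinearMap.range testToL2 : Set L2) := by
  rw [Submodule.dense_iff_topologicalClosure_eq_top, Submodule.topologicalClosure_eq_top_iff,
    Submodule.eq_bot_iff]
  intro h hh
  have hloc : LocallyIntegrableOn h (Ioi 0) halfMeasure :=
    ((Lp.memLp h).locallyIntegrable (by norm_num)).locallyIntegrableOn _
  have hae := isOpen_Ioi.ae_eq_zero_of_integral_contDiff_smul_eq_zero hloc fun g hg hgc hgs => by
    let f : Test :=
      { toFun := fun s => (g s : ℂ)
        contDiff' := Complex.ofRealCLM.contDiff.comp hg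
        hasCompactSupport' := hgc.comp_left (g := fun t : ℝ => (t : ℂ)) Complex.ofReal_zero
        tsupport_subset' :=
          (tsupport_comp_subset (g := fun t : ℝ => (t : ℂ)) Complex.ofReal_zero g).trans hgs }
    have h1 := (Submodule.mem_orthogonal _ _).1 hh (testToL2 f) (LinearMap.mem_range_self _ f)
    rw [L2.inner_def] at h1
    rw [← h1]
    refine integral_congr_ae ?_
    filter_upwards [coeFn_testToL2 f] with s hs
    have e : f s = (g s : ℂ) := rfl
    rw [hs, RCLike.inner_apply, e, Complex.conj_ofReal, mul_comm, Complex.real_smul]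
  rw [Lp.eq_zero_iff_ae_eq_zero]
  filter_upwards [hae, ae_restrict_mem measurableSet_Ioi] with s hs hpos
  exact hs hpos

theorem integrable_mul_norm_sq {W : ℝ → ℝ} (hW : ContinuousOn W (Ioi 0)) (f : Test) :
    Integrable (fun s => W s * ‖f s‖ ^ 2) halfMeasure := by
  obtain ⟨a, b, ha, hf⟩ := exists_Icc f
  have cf := f.continuous
  exact integrable_of_continuousOn (b := b) ha (hW.mul (by fun_prop : Continuous _).continuousOn)
    fun s hs => by simp [hf s hs]

theorem integrable_norm_sq (f : Test) : Integrable (fun s => ‖f s‖ ^ 2) halfMeasure := by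
  simpa using integrable_mul_norm_sq (continuousOn_const (c := 1)) f

theorem integrable_norm_deriv_sq (f : Test) :
    Integrable (fun s => ‖deriv f s‖ ^ 2) halfMeasure := by
  obtain ⟨a, b, ha, hf⟩ := exists_Icc f
  have hf' := deriv_eq_zero_of_notMem_Icc hf
  have cf' := continuous_deriv_test f
  exact integrable_of_continuousOn (b := b) ha (by fun_prop : Continuous _).continuousOn
    fun s hs => by simp [hf' s hs]

theorem continuousOn_inv_sq : ContinuousOn (fun s : ℝ => (s ^ 2)⁻¹) (Ioi 0) :=
  (continuous_pow 2).continuousOn.inv₀ fun _ hs => pow_ne_zero 2 (ne_of_gt hs)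

theorem continuousOn_inv_rpow (q : ℝ) : ContinuousOn (fun s : ℝ => (s ^ q)⁻¹) (Ioi 0) :=
  ContinuousOn.inv₀ (fun s hs =>
    (Real.continuousAt_rpow_const s q (Or.inl (ne_of_gt hs))).continuousWithinAt)
    fun _ hs => (Real.rpow_pos_of_pos hs q).ne'

theorem norm_sq_eq_integral (h : L2) : ‖h‖ ^ 2 = ∫ s, ‖h s‖ ^ 2 ∂halfMeasure := by
  have e : ((‖h‖ ^ 2 : ℝ) : ℂ) = ((∫ s, ‖h s‖ ^ 2 ∂halfMeasure : ℝ) : ℂ) := by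
    rw [← integral_complex_ofReal]
    have e := inner_self_eq_norm_sq_to_K (𝕜 := ℂ) h
    rw [L2.inner_def] at e
    push_cast
    refine e.symm.trans (integral_congr_ae (Eventually.of_forall fun s => ?_))
    simp [inner_self_eq_norm_sq_to_K]
  exact_mod_cast e

theorem norm_testToL2_sq (f : Test) : ‖testToL2 f‖ ^ 2 = ∫ s, ‖f s‖ ^ 2 ∂halfMeasure := by
  rw [norm_sq_eq_integral]
  refine integral_congr_ae ?_
  filter_upwards [coeFn_testToL2 f] with s hs
  rw [hs]

/-- The coefficient of `s⁻²` in the potential. -/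
noncomputable def hardyCoeff (d : ℕ) (q : ℝ) : ℝ :=
  (q ^ 2 * ((d : ℝ) - 1) ^ 2 - 2 * q * ((d : ℝ) - 1)) / 4

theorem quadForm_eq {d : ℕ} {q μ : ℝ} {x : (minimalOperator d q μ).domain} {f : Test}
    (hx : (x : L2) = testToL2 f) (hx' : minimalOperator d q μ x = diffExprToL2 d q μ f) :
    (minimalOperator d q μ).quadForm x = (∫ s, ‖deriv f s‖ ^ 2 ∂halfMeasure) +
      hardyCoeff d q * (∫ s, (s ^ 2)⁻¹ * ‖f s‖ ^ 2 ∂halfMeasure) -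
      μ * ∫ s, (s ^ q)⁻¹ * ‖f s‖ ^ 2 ∂halfMeasure := by
  have i2 := (integrable_mul_norm_sq continuousOn_inv_sq f).const_mul (hardyCoeff d q)
  have i12 : Integrable (fun s => ‖deriv f s‖ ^ 2 + hardyCoeff d q * ((s ^ 2)⁻¹ * ‖f s‖ ^ 2))
    halfMeasure := (integrable_norm_deriv_sq f).add i2
  rw [LinearPMap.quadForm, hx, hx', inner_testToL2_diffExprToL2, ← integral_const_mul,
    ← integral_const_mul, ← integral_add (integrable_norm_deriv_sq f) i2,
    ← integral_sub i12 ((integrable_mul_norm_sq (continuousOn_inv_rpow q) f).const_mul _)]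
  rw [← Complex.ofReal_re (∫ s, _ ∂halfMeasure), ← integral_complex_ofReal]
  congr 2 with s
  have h : ∀ z : ℂ, starRingEnd ℂ z * z = ((‖z‖ ^ 2 : ℝ) : ℂ) := fun z => by
    rw [Complex.conj_mul']; push_cast; rfl
  rw [h, h, potential, hardyCoeff]
  push_cast
  simp only [div_eq_mul_inv, mul_inv]
  ring

/-- Expand `∫ |f' - f / (2s)|² ≥ 0`. Since `|f|² / s` has integral derivative zero, the cross term
equals `-½ ∫ s⁻² |f|²`. -/
theorem hardy_inequality (f : Test) :
    ∫ s, (s ^ 2)⁻¹ * ‖f s‖ ^ 2 ∂halfMeasure ≤ 4 * ∫ s, ‖deriv f s‖ ^ 2 ∂halfMeasure := by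
  obtain ⟨a, b, ha, hf⟩ := exists_Icc f
  have cf := f.continuous
  have cf' := continuous_deriv_test f
  have hi : ContinuousOn (fun s : ℝ => s⁻¹) (Ioi 0) := continuousOn_inv₀.mono fun s hs => ne_of_gt hs
  have hre : ∀ s, HasDerivAt (fun s => ‖f s‖ ^ 2) (2 * ⟪f s, deriv f s⟫_ℝ) s := fun s =>
    (hasDerivAt_test f s).norm_sq
  have hcross : ContinuousOn (fun s => 2 * ⟪f s, deriv f s⟫_ℝ) (Ioi 0) :=
    (by fun_prop : Continuous _).continuousOn
  have i1 : Integrable (fun s => s⁻¹ * (2 * ⟪f s, deriv f s⟫_ℝ)) halfMeasure :=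
    integrable_of_continuousOn (b := b) ha (hi.mul hcross) fun s hs => by simp [hf s hs]
  have i2 := integrable_mul_norm_sq continuousOn_inv_sq f
  have i3 := integrable_norm_deriv_sq f
  have hibp : ∫ s, (-(s ^ 2)⁻¹ * ‖f s‖ ^ 2 + s⁻¹ * (2 * ⟪f s, deriv f s⟫_ℝ)) ∂halfMeasure = 0 := by
    refine integral_deriv_eq_zero (F := fun s => s⁻¹ * ‖f s‖ ^ 2) (b := b) ha
      (fun s hs => (hasDerivAt_inv (ne_of_gt hs)).mul (hre s)) ?_ fun s hs => ?_
    · exact (continuousOn_inv_sq.neg.mul (by fun_prop : Continuous _).continuousOn).add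
        (hi.mul hcross)
    · simp [hf s hs]
  have hsq : 0 ≤ ∫ s, (‖deriv f s‖ ^ 2 - 2⁻¹ * (s⁻¹ * (2 * ⟪f s, deriv f s⟫_ℝ)) +
      4⁻¹ * ((s ^ 2)⁻¹ * ‖f s‖ ^ 2)) ∂halfMeasure := by
    refine integral_nonneg fun s => ?_
    have h : ‖deriv f s - (2⁻¹ * s⁻¹) • f s‖ ^ 2 = ‖deriv f s‖ ^ 2 -
        2⁻¹ * (s⁻¹ * (2 * ⟪f s, deriv f s⟫_ℝ)) + 4⁻¹ * ((s ^ 2)⁻¹ * ‖f s‖ ^ 2) := by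
      rw [norm_sub_sq_real, inner_smul_right, norm_smul, mul_pow, Real.norm_eq_abs, sq_abs,
        real_inner_comm]
      simp only [mul_pow, inv_pow]
      ring
    change 0 ≤ _
    rw [← h]
    positivity
  have i31 : Integrable (fun s => ‖deriv f s‖ ^ 2 - 2⁻¹ * (s⁻¹ * (2 * ⟪f s, deriv f s⟫_ℝ)))
    halfMeasure := i3.sub (i1.const_mul _)
  rw [integral_add i31 (i2.const_mul _), integral_sub i3 (i1.const_mul _),
    integral_const_mul, integral_const_mul] at hsq
  simp only [neg_mul] at hibp
  have i2' : Integrable (fun s => -((s ^ 2)⁻¹ * ‖f s‖ ^ 2)) halfMeasure := i2.neg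
  rw [integral_add i2' i1, integral_neg] at hibp
  linarith

end HalfLine

namespace HalfLine

/-! ### The form is nonnegative up to small errors and forms of finite rank -/

/-- The variance `∫ (g - m)²` about the mean `m` is nonnegative. -/
theorem sq_intervalIntegral_le {g : ℝ → ℝ} (hg : Continuous g) {a b : ℝ} (hab : a < b) :
    (∫ s in a..b, g s) ^ 2 ≤ (b - a) * ∫ s in a..b, g s ^ 2 := by
  set m := (∫ s in a..b, g s) / (b - a) with hm
  have hℓ : 0 < b - a := sub_pos.2 hab
  have h : 0 ≤ ∫ s in a..b, (g s ^ 2 - 2 * m * g s + m ^ 2) :=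
    intervalIntegral.integral_nonneg hab.le fun s _ => by nlinarith [sq_nonneg (g s - m)]
  rw [intervalIntegral.integral_add
      ((by fun_prop : Continuous fun s => g s ^ 2 - 2 * m * g s).intervalIntegrable _ _)
      (by simp),
    intervalIntegral.integral_sub ((by fun_prop : Continuous _).intervalIntegrable _ _)
      ((by fun_prop : Continuous _).intervalIntegrable _ _),
    intervalIntegral.integral_const_mul, intervalIntegral.integral_const, smul_eq_mul] at h
  have e : ∫ s in a..b, g s = m * (b - a) := by rw [hm]; field_simp
  rw [e] at h ⊢
  nlinarith

/-- A Poincaré inequality on the interval `[a, b]`. -/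
theorem intervalIntegral_norm_sq_le {f f' : ℝ → ℂ} (hf : ∀ s, HasDerivAt f (f' s) s)
    (hc : Continuous f') {a b : ℝ} (hab : a < b) :
    ∫ s in a..b, ‖f s‖ ^ 2 ≤ 2 / (b - a) * ‖∫ s in a..b, f s‖ ^ 2 +
      2 * (b - a) ^ 2 * ∫ s in a..b, ‖f' s‖ ^ 2 := by
  have hℓ : 0 < b - a := sub_pos.2 hab
  have cf : Continuous f := continuous_iff_continuousAt.2 fun s => (hf s).continuousAt
  set M := ‖∫ s in a..b, f s‖ with hM
  set D := ∫ s in a..b, ‖f' s‖ with hD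
  have hD0 : 0 ≤ D := intervalIntegral.integral_nonneg hab.le fun s _ => norm_nonneg _
  have hD2 : D ^ 2 ≤ (b - a) * ∫ s in a..b, ‖f' s‖ ^ 2 := sq_intervalIntegral_le hc.norm hab
  -- The oscillation of `f` is at most `D`, so `f s` differs from the mean value of `f` by at most
  -- `D`.
  have hosc : ∀ s ∈ Icc a b, ∀ t ∈ Icc a b, ‖f s - f t‖ ≤ D := by
    intro s hs t ht
    rw [← intervalIntegral.integral_eq_sub_of_hasDerivAt (fun x _ => hf x)
      (hc.intervalIntegrable _ _)]
    refine intervalIntegral.norm_integral_le_integral_norm_uIoc.trans ?_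
    rw [hD, intervalIntegral.integral_of_le hab.le]
    refine setIntegral_mono_set hc.norm.integrableOn_Ioc
      (Eventually.of_forall fun x => norm_nonneg _) (LE.le.eventuallyLE ?_)
    exact Ioc_subset_Ioc (le_min ht.1 hs.1) (max_le ht.2 hs.2)
  have hpt : ∀ s ∈ Icc a b, ‖f s‖ ^ 2 ≤ 2 * (M / (b - a)) ^ 2 + 2 * D ^ 2 := by
    intro s hs
    have e : ((b - a : ℝ) : ℂ) * f s = (∫ t in a..b, f t) + ∫ t in a..b, (f s - f t) := by
      rw [intervalIntegral.integral_sub (by simp) (cf.intervalIntegrable _ _),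
        intervalIntegral.integral_const, Complex.real_smul]
      ring
    have h1 : ‖∫ t in a..b, (f s - f t)‖ ≤ D * (b - a) := by
      have := intervalIntegral.norm_integral_le_of_norm_le_const (a := a) (b := b) (C := D)
        (f := fun t => f s - f t) fun t ht => by
          rw [uIoc_of_le hab.le] at ht
          exact hosc s hs t ⟨ht.1.le, ht.2⟩
      rwa [abs_of_pos hℓ] at this
    have h2 : (b - a) * ‖f s‖ ≤ M + D * (b - a) := by
      have := congrArg norm e
      rw [norm_mul, Complex.norm_real, Real.norm_of_nonneg hℓ.le] at this
      rw [this]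
      exact (norm_add_le _ _).trans (by linarith)
    have h3 : ‖f s‖ ≤ M / (b - a) + D := by
      rw [← sub_le_iff_le_add, le_div_iff₀ hℓ]
      linarith
    have h4 : ‖f s‖ ^ 2 ≤ (M / (b - a) + D) ^ 2 := by gcongr
    nlinarith [sq_nonneg (M / (b - a) - D)]
  calc ∫ s in a..b, ‖f s‖ ^ 2 ≤ ∫ s in a..b, (2 * (M / (b - a)) ^ 2 + 2 * D ^ 2) :=
        intervalIntegral.integral_mono_on hab.le ((by fun_prop : Continuous _).intervalIntegrable _ _)
          (by simp) hpt
    _ = 2 / (b - a) * M ^ 2 + 2 * (b - a) * D ^ 2 := by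
        rw [intervalIntegral.integral_const, smul_eq_mul]
        field_simp
    _ ≤ _ := by
        have : 2 * (b - a) * D ^ 2 ≤ 2 * (b - a) * ((b - a) * ∫ s in a..b, ‖f' s‖ ^ 2) := by gcongr
        nlinarith

theorem inner_indicator_testToL2 {a b : ℝ} (ha : 0 ≤ a) (hab : a ≤ b)
    (hfin : halfMeasure (Ioc a b) ≠ ⊤) (f : Test) :
    ⟪indicatorConstLp 2 measurableSet_Ioc hfin (1 : ℂ), testToL2 f⟫_ℂ = ∫ s in a..b, f s := by
  have hsub : Ioc a b ⊆ Ioi 0 := fun s hs => lt_of_le_of_lt ha hs.1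
  rw [L2.inner_indicatorConstLp_one, intervalIntegral.integral_of_le hab]
  rw [setIntegral_congr_ae₀ (g := f) measurableSet_Ioc.nullMeasurableSet
    ((coeFn_testToL2 f).mono fun s h _ => h), Measure.restrict_restrict measurableSet_Ioc,
    inter_eq_left.2 hsub]

/-- On bounded intervals the `L²`-norm is small compared with the form, up to finite rank. -/
theorem exists_intervalIntegral_le {R κ : ℝ} (hR : 0 < R) (hκ : 0 < κ) :
    ∃ (N : ℕ) (g : Fin N → L2), ∀ f : Test, ∫ s in (0 : ℝ)..R, ‖f s‖ ^ 2 ≤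
      κ * (∫ s, ‖deriv f s‖ ^ 2 ∂halfMeasure) + ∑ i, ‖⟪g i, testToL2 f⟫_ℂ‖ ^ 2 := by
  have hlim : Tendsto (fun n : ℕ => 2 * (R / (n + 1 : ℝ)) ^ 2) atTop (𝓝 0) := by
    have h := ((tendsto_one_div_add_atTop_nhds_zero_nat (𝕜 := ℝ)).const_mul R).pow 2 |>.const_mul 2
    simpa [div_eq_mul_inv] using h
  -- The interval is cut into `n + 1` cells of length `ℓ`, so short that the Poincaré constant `2
  -- ℓ²` is at most `κ`.
  obtain ⟨n, hn⟩ := (hlim.eventually (ge_mem_nhds hκ)).exists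
  set N := n + 1 with hN
  set ℓ := R / (n + 1 : ℝ) with hℓ
  have hℓ0 : 0 < ℓ := by positivity
  set a : ℕ → ℝ := fun k => k * ℓ with ha
  have ha0 : ∀ k, 0 ≤ a k := fun k => by positivity
  have hastep : ∀ k, a (k + 1) - a k = ℓ := fun k => by simp only [ha]; push_cast; ring
  have haN : a N = R := by simp only [ha, hN, hℓ]; push_cast; field_simp
  have hfin : ∀ k, halfMeasure (Ioc (a k) (a (k + 1))) ≠ ⊤ := fun k =>
    ((Measure.restrict_apply_le _ _).trans_lt measure_Ioc_lt_top).ne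
  -- The functionals are the integrals over the cells; the factor squares to the coefficient `2 / ℓ`
  -- in the Poincaré inequality.
  refine ⟨N, fun i => ((Real.sqrt (2 / ℓ) : ℝ) : ℂ) •
    indicatorConstLp 2 measurableSet_Ioc (hfin i) (1 : ℂ), fun f => ?_⟩
  have cf := f.continuous
  have cf' := continuous_deriv_test f
  have hterm : ∀ k : ℕ, ‖⟪((Real.sqrt (2 / ℓ) : ℝ) : ℂ) •
      indicatorConstLp 2 measurableSet_Ioc (hfin k) (1 : ℂ), testToL2 f⟫_ℂ‖ ^ 2 =
      2 / ℓ * ‖∫ s in a k..a (k + 1), f s‖ ^ 2 := by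
    intro k
    rw [inner_smul_left, inner_indicator_testToL2 (ha0 k) (by linarith [hastep k]),
      norm_mul, mul_pow, Complex.conj_ofReal, Complex.norm_real,
      Real.norm_of_nonneg (Real.sqrt_nonneg _), Real.sq_sqrt (by positivity)]
  have hdint : ∫ s in (0 : ℝ)..R, ‖deriv f s‖ ^ 2 ≤ ∫ s, ‖deriv f s‖ ^ 2 ∂halfMeasure := by
    rw [intervalIntegral.integral_of_le hR.le]
    exact setIntegral_mono_set (integrable_norm_deriv_sq f)
      (Eventually.of_forall fun s => sq_nonneg _) Ioc_subset_Ioi_self.eventuallyLE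
  have hsum := intervalIntegral.sum_integral_adjacent_intervals (a := a) (n := N) (μ := volume)
    (f := fun s => ‖f s‖ ^ 2) fun k _ => (by fun_prop : Continuous _).intervalIntegrable _ _
  have hsum' := intervalIntegral.sum_integral_adjacent_intervals (a := a) (n := N) (μ := volume)
    (f := fun s => ‖deriv f s‖ ^ 2) fun k _ => (by fun_prop : Continuous _).intervalIntegrable _ _
  have ha00 : a 0 = 0 := by simp [ha]
  rw [ha00, haN] at hsum hsum'
  rw [← hsum]
  calc ∑ k ∈ Finset.range N, ∫ s in a k..a (k + 1), ‖f s‖ ^ 2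
      ≤ ∑ k ∈ Finset.range N, (2 / ℓ * ‖∫ s in a k..a (k + 1), f s‖ ^ 2 +
        2 * ℓ ^ 2 * ∫ s in a k..a (k + 1), ‖deriv f s‖ ^ 2) := by
        refine Finset.sum_le_sum fun k _ => ?_
        have h := intervalIntegral_norm_sq_le (hasDerivAt_test f) cf'
          (show a k < a (k + 1) by linarith [hastep k])
        rwa [hastep] at h
    _ = (∑ k ∈ Finset.range N, 2 / ℓ * ‖∫ s in a k..a (k + 1), f s‖ ^ 2) +
        2 * ℓ ^ 2 * ∫ s in (0 : ℝ)..R, ‖deriv f s‖ ^ 2 := by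
        rw [Finset.sum_add_distrib, ← Finset.mul_sum (a := 2 * ℓ ^ 2), hsum']
    _ ≤ (∑ k ∈ Finset.range N, 2 / ℓ * ‖∫ s in a k..a (k + 1), f s‖ ^ 2) +
        κ * ∫ s, ‖deriv f s‖ ^ 2 ∂halfMeasure := by
        have h0 : 0 ≤ ∫ s in (0 : ℝ)..R, ‖deriv f s‖ ^ 2 :=
          intervalIntegral.integral_nonneg hR.le fun s _ => sq_nonneg _
        gcongr
    _ = _ := by
        rw [add_comm]
        congr 1
        simp only [hterm]
        exact (Fin.sum_univ_eq_sum_range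
          (fun k => 2 / ℓ * ‖∫ s in a k..a (k + 1), f s‖ ^ 2) N).symm

/-- For `s ≤ δ` write `s^(-q) = s^(2-q) s⁻²`, where `s^(2-q)` is small because `q < 2`. For `s > R`
the function is small because `q > 0`. In between it is at most `C = δ^(-q)`. -/
theorem exists_inv_rpow_le {q η : ℝ} (hq0 : 0 < q) (hq2 : q < 2) (hη : 0 < η) :
    ∃ R C : ℝ, 0 < R ∧ 0 < C ∧ ∀ s > 0,
      (s ^ q)⁻¹ ≤ η * (s ^ 2)⁻¹ + η + (Ioc 0 R).indicator (fun _ => C) s := by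
  obtain ⟨δ, hδ0, hδ⟩ : ∃ δ > 0, δ ^ (2 - q) ≤ η :=
    ⟨η ^ (2 - q)⁻¹, Real.rpow_pos_of_pos hη _, by
      rw [← Real.rpow_mul hη.le, inv_mul_cancel₀ (by linarith), Real.rpow_one]⟩
  obtain ⟨R, hR0, hR⟩ : ∃ R > 0, (R ^ q)⁻¹ ≤ η :=
    ⟨η ^ (-q⁻¹), Real.rpow_pos_of_pos hη _, by
      rw [← Real.rpow_mul hη.le, neg_mul, inv_mul_cancel₀ hq0.ne', Real.rpow_neg_one, inv_inv]⟩
  refine ⟨R, (δ ^ q)⁻¹, hR0, inv_pos.2 (Real.rpow_pos_of_pos hδ0 _), fun s hs => ?_⟩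
  have hind : 0 ≤ (Ioc 0 R).indicator (fun _ => (δ ^ q)⁻¹) s :=
    indicator_nonneg (fun _ _ => inv_nonneg.2 (Real.rpow_nonneg hδ0.le _)) s
  have h2 : 0 ≤ η * (s ^ 2)⁻¹ := by positivity
  rcases le_total s δ with hsδ | hsδ
  · have e : (s ^ q)⁻¹ = s ^ (2 - q) * (s ^ 2)⁻¹ := by
      rw [Real.rpow_sub hs, Real.rpow_two]
      field_simp
    have h3 : s ^ (2 - q) * (s ^ 2)⁻¹ ≤ η * (s ^ 2)⁻¹ := by
      gcongr
      exact (Real.rpow_le_rpow hs.le hsδ (by linarith)).trans hδ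
    linarith
  · rcases le_or_gt s R with hsR | hsR
    · rw [indicator_of_mem (show s ∈ Ioc 0 R from ⟨hs, hsR⟩)]
      have h3 : (s ^ q)⁻¹ ≤ (δ ^ q)⁻¹ :=
        inv_anti₀ (Real.rpow_pos_of_pos hδ0 _) (Real.rpow_le_rpow hδ0.le hsδ hq0.le)
      linarith
    · have h3 : (s ^ q)⁻¹ ≤ (R ^ q)⁻¹ :=
        inv_anti₀ (Real.rpow_pos_of_pos hR0 _) (Real.rpow_le_rpow hR0.le hsR.le hq0.le)
      linarith

/-- The potential `s ^ (-q)` has relative form bound zero up to finite rank. -/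
theorem exists_integral_inv_rpow_le {q ε₁ ε₂ : ℝ} (hq0 : 0 < q) (hq2 : q < 2) (h1 : 0 < ε₁)
    (h2 : 0 < ε₂) :
    ∃ (N : ℕ) (g : Fin N → L2), ∀ f : Test, ∫ s, (s ^ q)⁻¹ * ‖f s‖ ^ 2 ∂halfMeasure ≤
      ε₁ * (∫ s, ‖deriv f s‖ ^ 2 ∂halfMeasure) + ε₂ * ‖testToL2 f‖ ^ 2 +
        ∑ i, ‖⟪g i, testToL2 f⟫_ℂ‖ ^ 2 := by
  -- With Hardy's constant `4`, the bound `η ≤ ε₁ / 8` costs `ε₁ / 2` of `∫ |f'|²`; the choice `κ =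
  -- ε₁ / (2C)` below costs the other half.
  obtain ⟨R, C, hR, hC, hRC⟩ := exists_inv_rpow_le hq0 hq2 (η := min (ε₁ / 8) ε₂)
    (lt_min (by linarith) h2)
  set η := min (ε₁ / 8) ε₂ with hη
  have hη0 : 0 < η := lt_min (by linarith) h2
  obtain ⟨N, g, hg⟩ := exists_intervalIntegral_le (κ := ε₁ / (2 * C)) hR (by positivity)
  refine ⟨N, fun i => ((Real.sqrt C : ℝ) : ℂ) • g i, fun f => ?_⟩
  set D := ∫ s, ‖deriv f s‖ ^ 2 ∂halfMeasure with hD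
  have hD0 : 0 ≤ D := integral_nonneg fun s => sq_nonneg _
  have hgf : ∑ i, ‖⟪((Real.sqrt C : ℝ) : ℂ) • g i, testToL2 f⟫_ℂ‖ ^ 2 =
      C * ∑ i, ‖⟪g i, testToL2 f⟫_ℂ‖ ^ 2 := by
    rw [Finset.mul_sum]
    refine Finset.sum_congr rfl fun i _ => ?_
    rw [inner_smul_left, norm_mul, mul_pow, Complex.conj_ofReal, Complex.norm_real,
      Real.norm_of_nonneg (Real.sqrt_nonneg _), Real.sq_sqrt hC.le]
  have i0 := integrable_norm_sq f
  have i2 := integrable_mul_norm_sq continuousOn_inv_sq f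
  have i3 : Integrable (fun s => C * (Ioc 0 R).indicator (fun s => ‖f s‖ ^ 2) s) halfMeasure :=
    (i0.indicator measurableSet_Ioc).const_mul C
  have i23 : Integrable (fun s => η * ((s ^ 2)⁻¹ * ‖f s‖ ^ 2) + η * ‖f s‖ ^ 2) halfMeasure :=
    (i2.const_mul η).add (i0.const_mul η)
  have hmono : ∫ s, (s ^ q)⁻¹ * ‖f s‖ ^ 2 ∂halfMeasure ≤
      ∫ s, (η * ((s ^ 2)⁻¹ * ‖f s‖ ^ 2) + η * ‖f s‖ ^ 2 +
        C * (Ioc 0 R).indicator (fun s => ‖f s‖ ^ 2) s) ∂halfMeasure := by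
    refine integral_mono_ae (integrable_mul_norm_sq (continuousOn_inv_rpow q) f) (i23.add i3) ?_
    filter_upwards [ae_restrict_mem measurableSet_Ioi] with s hs
    have h := mul_le_mul_of_nonneg_right (hRC s hs) (sq_nonneg ‖f s‖)
    refine h.trans_eq ?_
    by_cases hm : s ∈ Ioc 0 R
    · simp only [indicator_of_mem hm]
      ring
    · simp only [indicator_of_notMem hm]
      ring
  have hind : ∫ s, (Ioc 0 R).indicator (fun s => ‖f s‖ ^ 2) s ∂halfMeasure =
      ∫ s in (0 : ℝ)..R, ‖f s‖ ^ 2 := by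
    rw [integral_indicator measurableSet_Ioc, Measure.restrict_restrict measurableSet_Ioc,
      inter_eq_left.2 Ioc_subset_Ioi_self, intervalIntegral.integral_of_le hR.le]
  rw [integral_add i23 i3, integral_add (i2.const_mul η) (i0.const_mul η), integral_const_mul,
    integral_const_mul, integral_const_mul, hind, ← norm_testToL2_sq] at hmono
  rw [hgf]
  have b1 : η * ∫ s, (s ^ 2)⁻¹ * ‖f s‖ ^ 2 ∂halfMeasure ≤ ε₁ / 8 * (4 * D) := by
    have h0 : 0 ≤ ∫ s, (s ^ 2)⁻¹ * ‖f s‖ ^ 2 ∂halfMeasure := integral_nonneg fun s => by positivity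
    exact mul_le_mul (min_le_left _ _) (hardy_inequality f) h0 (by linarith)
  have b2 : η * ‖testToL2 f‖ ^ 2 ≤ ε₂ * ‖testToL2 f‖ ^ 2 := by
    gcongr
    exact min_le_right _ _
  have b3 := mul_le_mul_of_nonneg_left (hg f) hC.le
  have e : C * (ε₁ / (2 * C) * D + ∑ i, ‖⟪g i, testToL2 f⟫_ℂ‖ ^ 2) =
      ε₁ / 2 * D + C * ∑ i, ‖⟪g i, testToL2 f⟫_ℂ‖ ^ 2 := by
    field_simp
  rw [e] at b3
  linarith

/-- A nonnegative coefficient `c` does no harm. A negative one costs at most `4|c|` by Hardy's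
inequality and leaves `1 + 4c = (q(d-1) - 1)² > 0`. -/
theorem exists_pos_hardy {d : ℕ} {q : ℝ} (hd : 2 ≤ d) (hq1 : 1 < q) :
    ∃ θ > 0, ∀ f : Test, θ * ∫ s, ‖deriv f s‖ ^ 2 ∂halfMeasure ≤
      (∫ s, ‖deriv f s‖ ^ 2 ∂halfMeasure) +
        hardyCoeff d q * ∫ s, (s ^ 2)⁻¹ * ‖f s‖ ^ 2 ∂halfMeasure := by
  have hd' : (2 : ℝ) ≤ d := by exact_mod_cast hd
  have h1 : 0 < q * ((d : ℝ) - 1) - 1 := by nlinarith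
  have hc : 1 + 4 * hardyCoeff d q = (q * ((d : ℝ) - 1) - 1) ^ 2 := by
    rw [hardyCoeff]
    ring
  refine ⟨min 1 (1 + 4 * hardyCoeff d q), lt_min one_pos (by rw [hc]; positivity), fun f => ?_⟩
  have hH := hardy_inequality f
  have hD0 : 0 ≤ ∫ s, ‖deriv f s‖ ^ 2 ∂halfMeasure := integral_nonneg fun s => sq_nonneg _
  have h0 : 0 ≤ ∫ s, (s ^ 2)⁻¹ * ‖f s‖ ^ 2 ∂halfMeasure := integral_nonneg fun s => by positivity
  rcases le_total 0 (hardyCoeff d q) with hpos | hneg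
  · nlinarith [mul_nonneg hpos h0, min_le_left 1 (1 + 4 * hardyCoeff d q)]
  · nlinarith [min_le_right 1 (1 + 4 * hardyCoeff d q)]

theorem exists_le_quadForm {d : ℕ} {q μ : ℝ} (hd : 2 ≤ d) (hq1 : 1 < q) (hq2 : q < 2)
    (hμ : 0 < μ) : ∀ ε > 0, ∃ (N : ℕ) (g : Fin N → L2), ∀ x : (minimalOperator d q μ).domain,
      -ε * ‖(x : L2)‖ ^ 2 - ∑ i, ‖⟪g i, (x : L2)⟫_ℂ‖ ^ 2 ≤
        (minimalOperator d q μ).quadForm x := by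
  intro ε hε
  obtain ⟨θ, hθ, hθf⟩ := exists_pos_hardy hd hq1
  -- After multiplication by `μ` these constants become `θ`, which the Hardy bound absorbs, and `ε`.
  obtain ⟨N, g, hg⟩ := exists_integral_inv_rpow_le (q := q) (ε₁ := θ / μ) (ε₂ := ε / μ)
    (by linarith) hq2 (by positivity) (by positivity)
  refine ⟨N, fun i => ((Real.sqrt μ : ℝ) : ℂ) • g i, fun x => ?_⟩
  obtain ⟨f, hx, hx'⟩ := exists_test_eq x
  rw [quadForm_eq hx hx', hx]
  have hgf : ∑ i, ‖⟪((Real.sqrt μ : ℝ) : ℂ) • g i, testToL2 f⟫_ℂ‖ ^ 2 =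
      μ * ∑ i, ‖⟪g i, testToL2 f⟫_ℂ‖ ^ 2 := by
    rw [Finset.mul_sum]
    refine Finset.sum_congr rfl fun i _ => ?_
    rw [inner_smul_left, norm_mul, mul_pow, Complex.conj_ofReal, Complex.norm_real,
      Real.norm_of_nonneg (Real.sqrt_nonneg _), Real.sq_sqrt hμ.le]
  have h1 := mul_le_mul_of_nonneg_left (hg f) hμ.le
  have h2 := hθf f
  have e : μ * (θ / μ * (∫ s, ‖deriv f s‖ ^ 2 ∂halfMeasure) + ε / μ * ‖testToL2 f‖ ^ 2 +
      ∑ i, ‖⟪g i, testToL2 f⟫_ℂ‖ ^ 2) = θ * (∫ s, ‖deriv f s‖ ^ 2 ∂halfMeasure) +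
        ε * ‖testToL2 f‖ ^ 2 + μ * ∑ i, ‖⟪g i, testToL2 f⟫_ℂ‖ ^ 2 := by
    field_simp
  rw [e] at h1
  rw [hgf]
  linarith

theorem isSemibounded_minimalOperator {d : ℕ} {q μ : ℝ} (hd : 2 ≤ d) (hq1 : 1 < q) (hq2 : q < 2)
    (hμ : 0 < μ) : (minimalOperator d q μ).IsSemibounded where
  dense := dense_range_testToL2
  symm := minimalOperator_symm d q μ
  bddBelow := by
    -- A form of finite rank is bounded, so the case `ε = 1` already gives a lower bound.
    obtain ⟨N, g, hg⟩ := exists_le_quadForm (d := d) hd hq1 hq2 hμ 1 one_pos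
    refine ⟨1 + ∑ i, ‖g i‖ ^ 2, fun x => le_trans ?_ (hg x)⟩
    have h : ∑ i, ‖⟪g i, (x : L2)⟫_ℂ‖ ^ 2 ≤ (∑ i, ‖g i‖ ^ 2) * ‖(x : L2)‖ ^ 2 := by
      rw [Finset.sum_mul]
      refine Finset.sum_le_sum fun i _ => ?_
      rw [← mul_pow]
      gcongr
      exact norm_inner_le_norm _ _
    linarith

end HalfLine

namespace HalfLine

/-! ### Approximate eigenvectors for nonnegative energies -/

/-- The profile is arbitrary so that the formula can be applied to the cutoff and then to its
derivative. -/
theorem hasDerivAt_exp_mul_dilation {ψ ψ' : ℝ → ℝ} (hψ : ∀ s, HasDerivAt ψ (ψ' s) s) (k n : ℝ)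
    (s : ℝ) :
    HasDerivAt (fun s : ℝ => Complex.exp (Complex.I * k * s) * (ψ (s / n) : ℂ))
      (Complex.I * k * (Complex.exp (Complex.I * k * s) * (ψ (s / n) : ℂ)) +
        (n : ℂ)⁻¹ * (Complex.exp (Complex.I * k * s) * (ψ' (s / n) : ℂ))) s := by
  have h1 : HasDerivAt (fun s : ℝ => Complex.exp (Complex.I * k * s))
      (Complex.exp (Complex.I * k * s) * (Complex.I * k * 1)) s :=
    (Complex.ofRealCLM.hasDerivAt (x := s)).const_mul (Complex.I * k) |>.cexp
  have h2 : HasDerivAt (fun s : ℝ => (ψ (s / n) : ℂ)) ((ψ' (s / n) * (1 / n) : ℝ) : ℂ) s :=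
    ((hψ (s / n)).comp s ((hasDerivAt_id s).div_const n)).ofReal_comp
  refine (h1.fun_mul h2).congr_deriv ?_
  simp only [Complex.ofReal_mul, Complex.ofReal_div, Complex.ofReal_one]
  ring

/-- A smooth cutoff function on `[1, 5]` that is `1` on `[2, 4]`. -/
noncomputable def cutoff : ContDiffBump (3 : ℝ) := ⟨1, 2, one_pos, one_lt_two⟩

theorem cutoff_eq_zero {s : ℝ} (hs : s ∉ Icc (1 : ℝ) 5) : cutoff s = 0 := by
  refine cutoff.zero_of_le_dist ?_
  change 2 ≤ dist s 3
  rw [Real.dist_eq]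
  by_contra! h
  rw [abs_lt] at h
  exact hs ⟨by linarith, by linarith⟩

theorem cutoff_eq_one {s : ℝ} (hs : s ∈ Icc (2 : ℝ) 4) : cutoff s = 1 := by
  refine cutoff.one_of_mem_closedBall ?_
  change dist s 3 ≤ 1
  rw [Real.dist_eq, abs_le]
  exact ⟨by linarith [hs.1], by linarith [hs.2]⟩

theorem hasDerivAt_cutoff (s : ℝ) : HasDerivAt cutoff (deriv cutoff s) s :=
  ((cutoff.contDiff (n := 1)).differentiable (by norm_num) s).hasDerivAt

theorem contDiff_deriv_cutoff : ContDiff ℝ 1 (deriv cutoff) :=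
  (contDiff_succ_iff_deriv (n := 1).1 (cutoff.contDiff (n := 1 + 1))).2.2

theorem hasDerivAt_deriv_cutoff (s : ℝ) :
    HasDerivAt (deriv cutoff) (deriv (deriv cutoff) s) s :=
  (contDiff_deriv_cutoff.differentiable (by norm_num) s).hasDerivAt

/-- The wave `exp (i k s)` cut off to the interval `[n, 5 n]`. -/
noncomputable def wave (k : ℝ) {n : ℝ} (hn : 0 < n) : Test where
  toFun s := Complex.exp (Complex.I * k * s) * (cutoff (s / n) : ℂ)
  contDiff' := by
    refine ContDiff.mul ?_ ?_
    · exact (contDiff_const.mul Complex.ofRealCLM.contDiff).cexp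
    · exact Complex.ofRealCLM.contDiff.comp (cutoff.contDiff.comp (contDiff_id.div_const n))
  hasCompactSupport' := by
    refine HasCompactSupport.intro (isCompact_Icc (a := n) (b := 5 * n)) fun s hs => ?_
    rw [cutoff_eq_zero, Complex.ofReal_zero, mul_zero]
    exact fun h => hs ⟨by linarith [(le_div_iff₀ hn).1 h.1], (div_le_iff₀ hn).1 h.2⟩
  tsupport_subset' := by
    refine (closure_minimal (t := Icc n (5 * n)) (fun s hs => ?_) isClosed_Icc).trans
      fun s hs => lt_of_lt_of_le hn hs.1
    by_contra hns
    refine hs ?_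
    beta_reduce
    rw [cutoff_eq_zero, Complex.ofReal_zero, mul_zero]
    exact fun h => hns ⟨by linarith [(le_div_iff₀ hn).1 h.1], (div_le_iff₀ hn).1 h.2⟩

theorem wave_apply (k : ℝ) {n : ℝ} (hn : 0 < n) (s : ℝ) :
    wave k hn s = Complex.exp (Complex.I * k * s) * (cutoff (s / n) : ℂ) := rfl

theorem deriv_deriv_wave (k : ℝ) {n : ℝ} (hn : 0 < n) (s : ℝ) :
    deriv (deriv (wave k hn)) s = Complex.exp (Complex.I * k * s) * (-(k : ℂ) ^ 2 * cutoff (s / n) +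
      2 * Complex.I * k * (n : ℂ)⁻¹ * (deriv cutoff (s / n) : ℝ) +
      (n : ℂ)⁻¹ ^ 2 * (deriv (deriv cutoff) (s / n) : ℝ)) := by
  have h1 : deriv (wave k hn) = fun s : ℝ =>
      Complex.I * k * (Complex.exp (Complex.I * k * s) * (cutoff (s / n) : ℂ)) +
        (n : ℂ)⁻¹ * (Complex.exp (Complex.I * k * s) * (deriv cutoff (s / n) : ℝ)) :=
    funext fun s => (hasDerivAt_exp_mul_dilation hasDerivAt_cutoff k n s).deriv
  rw [h1, (((hasDerivAt_exp_mul_dilation hasDerivAt_cutoff k n s).const_mul _).fun_add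
    ((hasDerivAt_exp_mul_dilation hasDerivAt_deriv_cutoff k n s).const_mul _)).deriv]
  linear_combination (k ^ 2 * Complex.exp (Complex.I * k * s) * (cutoff (s / n) : ℂ)) *
    Complex.I_sq

theorem norm_exp_I_mul (k s : ℝ) : ‖Complex.exp (Complex.I * k * s)‖ = 1 := by
  have e : Complex.I * k * s = ((k * s : ℝ) : ℂ) * Complex.I := by push_cast; ring
  rw [e, Complex.norm_exp_ofReal_mul_I]

/-- The wave has modulus `1` on `[2n, 4n]`. -/
theorem le_norm_wave_sq (k : ℝ) {n : ℝ} (hn : 0 < n) : 2 * n ≤ ‖testToL2 (wave k hn)‖ ^ 2 := by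
  have hsub : Icc (2 * n) (4 * n) ⊆ Ioi 0 := fun s hs => lt_of_lt_of_le (by linarith) hs.1
  have h1 : ∫ s, (Icc (2 * n) (4 * n)).indicator (fun _ => (1 : ℝ)) s ∂halfMeasure = 2 * n := by
    rw [integral_indicator_const _ measurableSet_Icc, measureReal_restrict_apply measurableSet_Icc,
      inter_eq_left.2 hsub, Real.volume_real_Icc_of_le (by linarith), smul_eq_mul]
    ring
  rw [norm_testToL2_sq, ← h1]
  refine integral_mono_of_nonneg (Eventually.of_forall fun s =>
    indicator_nonneg (fun _ _ => zero_le_one) s) (integrable_norm_sq _)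
    (Eventually.of_forall fun s => ?_)
  refine indicator_le' (f := fun _ => (1 : ℝ)) (g := fun s => ‖wave k hn s‖ ^ 2)
    (fun s hs => ?_) (fun s _ => sq_nonneg _) s
  rw [wave_apply, norm_mul, norm_exp_I_mul, cutoff_eq_one ⟨(le_div_iff₀ hn).2 hs.1,
    (div_le_iff₀ hn).2 hs.2⟩]
  simp

/-- For `s ≥ 1` both `s²` and `s^q` are at least `s`, hence at least `n`. -/
theorem abs_potential_le {d : ℕ} {q μ : ℝ} (hq1 : 1 < q) (hμ : 0 < μ) {s n : ℝ} (hn : 1 ≤ n)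
    (hs : n ≤ s) : |potential d q μ s| ≤ (|hardyCoeff d q| + μ) / n := by
  have hn0 : 0 < n := by linarith
  have hs1 : 1 ≤ s := hn.trans hs
  have hs0 : 0 < s := by linarith
  have e : potential d q μ s = hardyCoeff d q * (s ^ 2)⁻¹ - μ * (s ^ q)⁻¹ := by
    rw [potential, hardyCoeff]
    simp only [div_eq_mul_inv, mul_inv]
    ring
  have h1 : (s ^ 2)⁻¹ ≤ n⁻¹ := inv_anti₀ hn0 (by nlinarith)
  have h2 : (s ^ q)⁻¹ ≤ n⁻¹ := by
    refine inv_anti₀ hn0 (hs.trans ?_)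
    have := Real.rpow_le_rpow_of_exponent_le hs1 hq1.le
    rwa [Real.rpow_one] at this
  have h3 : 0 ≤ (s ^ q)⁻¹ := by positivity
  rw [e]
  calc |hardyCoeff d q * (s ^ 2)⁻¹ - μ * (s ^ q)⁻¹|
      ≤ |hardyCoeff d q * (s ^ 2)⁻¹| + |μ * (s ^ q)⁻¹| := abs_sub _ _
    _ = |hardyCoeff d q| * (s ^ 2)⁻¹ + μ * (s ^ q)⁻¹ := by
        rw [abs_mul, abs_mul, abs_of_pos hμ, abs_of_nonneg h3,
          abs_of_pos (show 0 < (s ^ 2)⁻¹ by positivity)]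
    _ ≤ |hardyCoeff d q| * n⁻¹ + μ * n⁻¹ := by gcongr
    _ = _ := by ring

/-- The main term `k²` cancels. What remains carries a derivative of the dilated cutoff, hence a
factor `1/n` or `1/n²`, or the potential, which is of order `1/n` on `[n, 5n]`. -/
theorem exists_norm_diffExpr_wave_sub_le (d : ℕ) {q μ : ℝ} (hq1 : 1 < q) (hμ : 0 < μ) (k : ℝ) :
    ∃ M, 0 ≤ M ∧ ∀ (n : ℝ) (hn : 0 < n), 1 ≤ n → ∀ s,
      ‖diffExpr d q μ (wave k hn) s - ((k ^ 2 : ℝ) : ℂ) * wave k hn s‖ ≤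
        (Icc n (5 * n)).indicator (fun _ => M / n) s := by
  have hc1 : HasCompactSupport (deriv cutoff) := cutoff.hasCompactSupport.deriv
  obtain ⟨B₁, hB₁⟩ := contDiff_deriv_cutoff.continuous.bounded_above_of_compact_support hc1
  obtain ⟨B₂, hB₂⟩ := (contDiff_deriv_cutoff.continuous_deriv
    (by norm_num)).bounded_above_of_compact_support hc1.deriv
  have hB₁0 : 0 ≤ B₁ := (norm_nonneg _).trans (hB₁ 0)
  have hB₂0 : 0 ≤ B₂ := (norm_nonneg _).trans (hB₂ 0)
  refine ⟨2 * |k| * B₁ + B₂ + (|hardyCoeff d q| + μ), by positivity, fun n hn hn1 s => ?_⟩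
  have e : diffExpr d q μ (wave k hn) s - ((k ^ 2 : ℝ) : ℂ) * wave k hn s =
      Complex.exp (Complex.I * k * s) * (-(2 * Complex.I * k * (n : ℂ)⁻¹ *
        (deriv cutoff (s / n) : ℝ)) - (n : ℂ)⁻¹ ^ 2 * (deriv (deriv cutoff) (s / n) : ℝ) +
        (potential d q μ s : ℂ) * (cutoff (s / n) : ℝ)) := by
    rw [diffExpr, deriv_deriv_wave, wave_apply]
    push_cast
    ring
  rw [e, norm_mul, norm_exp_I_mul, one_mul]
  by_cases hs : s ∈ Icc n (5 * n)
  · rw [indicator_of_mem hs]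
    have h1 : ‖2 * Complex.I * k * (n : ℂ)⁻¹ * (deriv cutoff (s / n) : ℝ)‖ ≤
        2 * |k| * B₁ / n := by
      have hb := hB₁ (s / n)
      simp only [norm_mul, norm_inv, Complex.norm_real, Complex.norm_I, Complex.norm_ofNat,
        Real.norm_eq_abs, abs_of_pos hn, mul_one] at hb ⊢
      calc _ ≤ 2 * |k| * n⁻¹ * B₁ := by gcongr
        _ = _ := by ring
    have h2 : ‖(n : ℂ)⁻¹ ^ 2 * (deriv (deriv cutoff) (s / n) : ℝ)‖ ≤ B₂ / n := by
      have hb := hB₂ (s / n)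
      simp only [norm_mul, norm_pow, norm_inv, Complex.norm_real,
        Real.norm_eq_abs, abs_of_pos hn] at hb ⊢
      have hni : n⁻¹ ^ 2 ≤ n⁻¹ := by
        rw [sq]
        exact mul_le_of_le_one_left (by positivity) (inv_le_one_of_one_le₀ hn1)
      calc _ ≤ n⁻¹ * B₂ := mul_le_mul hni hb (abs_nonneg _) (by positivity)
        _ = _ := by ring
    have h3 : ‖(potential d q μ s : ℂ) * (cutoff (s / n) : ℝ)‖ ≤ (|hardyCoeff d q| + μ) / n := by
      rw [norm_mul, Complex.norm_real, Complex.norm_real, Real.norm_eq_abs,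
        Real.norm_of_nonneg cutoff.nonneg]
      exact (mul_le_of_le_one_right (abs_nonneg _) cutoff.le_one).trans
        (abs_potential_le hq1 hμ hn1 hs.1)
    calc _ ≤ 2 * |k| * B₁ / n + B₂ / n + (|hardyCoeff d q| + μ) / n := by
          refine (norm_add_le _ _).trans (add_le_add ((norm_sub_le _ _).trans ?_) h3)
          rw [norm_neg]
          exact add_le_add h1 h2
      _ = _ := by ring
  · have hs' : s / n ∉ Icc (1 : ℝ) 5 := fun h =>
      hs ⟨by linarith [(le_div_iff₀ hn).1 h.1], (div_le_iff₀ hn).1 h.2⟩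
    have z0 : ∀ t ∉ Icc (1 : ℝ) 5, cutoff t = 0 := fun t ht => cutoff_eq_zero ht
    have z1 := deriv_eq_zero_of_notMem_Icc z0
    have z2 := deriv_eq_zero_of_notMem_Icc z1
    rw [indicator_of_notMem hs, z0 _ hs', z1 _ hs', z2 _ hs']
    simp

/-- A pointwise error `M / n` on an interval of length `4n` has squared norm at most `4M² / n`,
whereas the squared norm of the wave grows like `n`. -/
theorem exists_norm_diffExprToL2_wave_sub_le (d : ℕ) {q μ : ℝ} (hq1 : 1 < q) (hμ : 0 < μ) (k : ℝ) :
    ∃ M, 0 ≤ M ∧ ∀ (n : ℝ) (hn : 0 < n), 1 ≤ n →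
      ‖diffExprToL2 d q μ (wave k hn) - ((k ^ 2 : ℝ) : ℂ) • testToL2 (wave k hn)‖ ^ 2 ≤
        4 * M ^ 2 / n := by
  obtain ⟨M, hM, hb⟩ := exists_norm_diffExpr_wave_sub_le d hq1 hμ k
  refine ⟨M, hM, fun n hn hn1 => ?_⟩
  have hsub : Icc n (5 * n) ⊆ Ioi 0 := fun s hs => lt_of_lt_of_le hn hs.1
  have hvol : halfMeasure.real (Icc n (5 * n)) = 4 * n := by
    rw [measureReal_restrict_apply measurableSet_Icc, inter_eq_left.2 hsub,
      Real.volume_real_Icc_of_le (by linarith)]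
    ring
  have hfin : halfMeasure (Icc n (5 * n)) ≠ ⊤ :=
    ((Measure.restrict_apply_le _ _).trans_lt measure_Icc_lt_top).ne
  have h1 : ∫ s, (Icc n (5 * n)).indicator (fun _ => (M / n) ^ 2) s ∂halfMeasure =
      4 * M ^ 2 / n := by
    rw [integral_indicator_const _ measurableSet_Icc, hvol, smul_eq_mul]
    field_simp
  rw [norm_sq_eq_integral, ← h1]
  refine integral_mono_of_nonneg (Eventually.of_forall fun s => sq_nonneg _)
    ((integrable_indicator_iff measurableSet_Icc).2 (integrableOn_const hfin)) ?_
  filter_upwards [Lp.coeFn_sub (diffExprToL2 d q μ (wave k hn))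
    (((k ^ 2 : ℝ) : ℂ) • testToL2 (wave k hn)),
    Lp.coeFn_smul ((k ^ 2 : ℝ) : ℂ) (testToL2 (wave k hn)),
    coeFn_testToL2 (wave k hn), coeFn_diffExprToL2 d q μ (wave k hn)] with s e1 e2 e3 e4
  rw [e1, Pi.sub_apply, e2, Pi.smul_apply, e3, e4, smul_eq_mul]
  have h := hb n hn hn1 s
  by_cases hs : s ∈ Icc n (5 * n)
  · rw [indicator_of_mem hs] at h ⊢
    gcongr
  · rw [indicator_of_notMem hs] at h ⊢
    rw [le_antisymm h (norm_nonneg _)]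
    simp

theorem mem_unboundedSpectrum_friedrichsExtension {d : ℕ} {q μ : ℝ} (hq1 : 1 < q) (hμ : 0 < μ)
    (h : (minimalOperator d q μ).IsSemibounded) {r : ℝ} (hr : 0 ≤ r) :
    (r : ℂ) ∈ ((minimalOperator d q μ).friedrichsExtension h).unboundedSpectrum := by
  refine LinearPMap.mem_unboundedSpectrum_of_forall_exists fun ε hε => ?_
  obtain ⟨M, hM, hb⟩ := exists_norm_diffExprToL2_wave_sub_le d hq1 hμ (Real.sqrt r)
  -- Chosen so that `4M² / n ≤ ε² n`, which is at most `ε²` times the squared norm of the wave.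
  set n := max 1 (2 * M / ε) with hn
  have hn1 : 1 ≤ n := le_max_left _ _
  have hn0 : 0 < n := by linarith
  set f := wave (Real.sqrt r) hn0 with hf
  have hle := LinearPMap.le_friedrichsExtension h
  have hfd : testToL2 f ∈ (minimalOperator d q μ).domain := LinearMap.mem_range_self _ f
  have hval : (minimalOperator d q μ).friedrichsExtension h ⟨testToL2 f, hle.1 hfd⟩ =
      diffExprToL2 d q μ f :=
    (hle.2 (x := ⟨testToL2 f, hfd⟩) (y := ⟨testToL2 f, hle.1 hfd⟩) rfl).symm.trans
      (minimalOperator_apply d q μ f)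
  have hlow := le_norm_wave_sq (Real.sqrt r) hn0
  refine ⟨⟨testToL2 f, hle.1 hfd⟩, fun h0 => ?_, ?_⟩
  · change testToL2 f = 0 at h0
    rw [← hf, h0, norm_zero] at hlow
    linarith
  · rw [hval]
    have hup := hb n hn0 hn1
    rw [Real.sq_sqrt hr, ← hf] at hup
    rw [← hf] at hlow
    refine le_of_sq_le_sq ?_ (by positivity)
    have hMn : 2 * M ≤ ε * n := by
      have := le_max_right 1 (2 * M / ε)
      rw [← hn, div_le_iff₀ hε] at this
      linarith
    have h4 : 4 * M ^ 2 ≤ (ε * n) ^ 2 := by nlinarith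
    calc _ ≤ 4 * M ^ 2 / n := hup
      _ ≤ (ε * n) ^ 2 / n := by gcongr
      _ = ε ^ 2 * n := by field_simp
      _ ≤ ε ^ 2 * ‖testToL2 f‖ ^ 2 := by gcongr; linarith
      _ = _ := by rw [mul_pow]

end HalfLine

/-- For `d ≥ 2`, `1 < q < 2` and `μ > 0` the operator `f ↦ -f'' + V_μ f` on `C_c^∞(0, ∞)` is densely
defined, symmetric and bounded from below, and its Friedrichs extension `L_μ` is a self-adjoint
operator in `L²(0, ∞)` with essential spectrum `[0, ∞)`. -/
theorem corollaryA3 (d : ℕ) (hd : 2 ≤ d) (q : ℝ) (hq1 : 1 < q) (hq2 : q < 2)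
    (μ : ℝ) (hμ : 0 < μ) :
    ∃ h : (HalfLine.minimalOperator d q μ).IsSemibounded,
      IsSelfAdjoint ((HalfLine.minimalOperator d q μ).friedrichsExtension h) ∧
      ((HalfLine.minimalOperator d q μ).friedrichsExtension h).essentialSpectrum =
        (fun r : ℝ => (r : ℂ)) '' Set.Ici (0 : ℝ) := by
  have h := HalfLine.isSemibounded_minimalOperator hd hq1 hq2 hμ
  have hA := LinearPMap.isSelfAdjoint_friedrichsExtension h
  exact ⟨h, hA, LinearPMap.essentialSpectrum_eq_of_isFormBoundedBelowModFiniteRank hA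
    (LinearPMap.isFormBoundedBelowModFiniteRank_friedrichsExtension h
      (HalfLine.exists_le_quadForm hd hq1 hq2 hμ))
    fun _ hr => HalfLine.mem_unboundedSpectrum_friedrichsExtension hq1 hμ h hr⟩
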